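/- **Setting.** Write $z_n=\frac1n$ for $n\ge1$. Let $T_L$ be the Lüroth map on $[0,1]$: $T_L(0)=0$, $T_L(1)=1$ and $T_L(x)=\lceil\frac1x\rceil(\lceil\frac1x\rceil-1)x-(\lceil\frac1x\rceil-1)$ otherwise; let $T_A=1-T_L$. Let $T_0=T_L$ and $T_1=T_A$, except that $T_0=T_1=1$ at $0$ and at every $z_n$, $n\ge1$. The random Lüroth map ($c=0$) is $L(\omega,x)=(\sigma\omega,T_{\omega_1}x)$ on $\{0,1\}^{\mathbb N}\times[0,1]$, and $T_\omega^n=T_{\omega_n}\circ\dots\circ T_{\omega_1}$. For $x\in(0,1]$ and $i\ge1$ put $y=T_\omega^{i-1}x\in(0,1]$. The digit is $d_i=2$ if $y=1$ and $d_i=n$ if $y\in[\frac1n,\frac1{n-1})$, $n\ge 2$. The sign is $s_i=\omega_i$ if $y\notin\{z_n:n\ge1\}$, $s_i=1$ if $y=z_n$ with $n\ge2$, and $s_i=0$ if $y=1$. A generalised Lüroth expansion of $x$ is a sequence $(s_n,d_n)_{n\ge1}$ in $\{0,1\}\times\mathbb N_{\ge2}$ with $$x=\sum_{n\ge1}(-1)^{s_1+\dots+s_{n-1}}\frac{d_n-1+s_n}{\prod_{i=1}^n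 d_i(d_i-1)};$$ it is universal if every finite block over $\{0,1\}\times\mathbb N_{\ge2}$ occurs in it. For $(\omega,x)$ let $\frac{p_n}{q_n}$ be the $n$-th partial sum of this series for $(s_i,d_i)=(s_i(\omega,x),d_i(\omega,x))$, let $q_n=(d_n-s_n)\prod_{i<n}d_i(d_i-1)$, $\theta_n=q_n|x-\frac{p_n}{q_n}|$, and let $\Lambda(\omega,x)=\lim_n\frac1n\log|\frac{d}{dx}T_\omega^n(x)|$ whenever these derivatives (on $[0,1]$) and the limit exist. Let $\lambda$ be Lebesgue measure on $[0,1]$ and $m_p$ the $(p,1-p)$-Bernoulli measure on $\{0,1\}^{\mathbb N}$. For $0<z\le 1$ let $$F_L(z)=\sum_{k=2}^{\lfloor 1/z\rfloor+1}\frac zk+\frac1{\lfloor 1/z\rfloor+1},\qquad F_A(z)=\sum_{k=2}^{\lfloor 1/z\rfloor}\frac z{k-1}+\frac1{\lfloor 1/z\rfloor}$$ (the limiting distribution functions of the approximation coefficients of $T_L$ and $T_A$), and let $M_L=\int_0^1(1-F_L)\,d\lambda$, $M_A=\int_0^1(1-F_A)\,d\lambda$. **Theorem B.** Let $0<p<1$.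 (i) For Lebesgue almost every $x\in[0,1]$, the map $L$ produces uncountably many universal generalised Lüroth expansions of $x$: there are uncountably many universal generalised Lüroth expansions of $x$ of the form $(s_n(\omega,x),d_n(\omega,x))_{n\ge1}$, $\omega\in\{0,1\}^{\mathbb N}$. (ii) For all $\omega\in\{0,1\}^{\mathbb N}$ and $x\in(0,1]$ for which $\Lambda(\omega,x)$ exists, $\lim_n\frac1n\log|x-\frac{p_n}{q_n}|=-\Lambda(\omega,x)$. For $m_p\times\lambda$-almost every $(\omega,x)$, $$\Lambda(\omega,x)=\sum_{d=2}^\infty\frac{\log(d(d-1))}{d(d-1)}\quad\text{and}\quad\lim_{n\to\infty}\frac1n\log\Big|x-\frac{p_n}{q_n}\Big|=-\sum_{d=2}^\infty\frac{\log(d(d-1))}{d(d-1)},$$ where the series converges; in particular the typical rate does not depend on $p$. As $(\omega,x)$ runs over the points of $\{0,1\}^{\mathbb N}\times(0,1]$ at which the respective limit exists in $\mathbb R$, the set of values of $\Lambda$ is $[\log2,\infty)$ and the set of values of the rate $\lim_n\frac1n\log|x-\frac{p_n}{q_n}|$ is $(-\infty,-\log2]$. (iii) Let $M_q=q\,\frac{2\zeta(2)-3}{2}+\frac{2-\zeta(2)}{2}$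 for $q\in[0,1]$. For $m_p\times\lambda$-almost every $(\omega,x)$, $\lim_{n\to\infty}\frac1n\sum_{i=1}^n\theta_i(\omega,x)=M_p$; moreover, for every $n\ge1$, $\theta_n$ is integrable and $\mathbb E[\theta_n]=\int\theta_n\,d(m_p\times\lambda)=M_p$. The function $q\mapsto M_q$ maps $[0,1]$ onto $[M_A,M_L]$. -/

import Mathlib

open Filter Topology MeasureTheory Set

noncomputable section

namespace RandomLuroth

/-- The standard Lueroth map `T_L` on `[0,1]`. -/
def mapL (x : ℝ) : ℝ :=
  if x = 0 then 0
  else if x = 1 then 1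
  else (⌈1 / x⌉ : ℝ) * ((⌈1 / x⌉ : ℝ) - 1) * x - ((⌈1 / x⌉ : ℝ) - 1)

/-- The alternating Lueroth map `T_A = 1 - T_L`. -/
def mapA (x : ℝ) : ℝ := 1 - mapL x

/-- `x` is one of the points `z_n = 1 / n`, `n ≥ 1`. -/
def IsPartitionPoint (x : ℝ) : Prop := ∃ n : ℕ, 1 ≤ n ∧ x = 1 / (n : ℝ)

open Classical in
/-- The maps `T_{0,0}` and `T_{1,0}` on `[0,1]`: they equal `T_L` and `T_A` respectively, except
that both take the value `1` at `0` and at all points `1 / n`, so that `0` is never attained. -/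
def mapT (j : Fin 2) (x : ℝ) : ℝ :=
  if x = 0 ∨ IsPartitionPoint x then 1
  else if j = 0 then mapL x
  else mapA x

/-- The random Lueroth transformation `L_0(ω, x) = (σ ω, T_{ω_1} x)`. The letters of `ω` are
indexed from `0`, so that `ω 0` is the first letter. -/
def randomMap (z : (ℕ → Fin 2) × ℝ) : (ℕ → Fin 2) × ℝ :=
  (fun i => z.1 (i + 1), mapT (z.1 0) z.2)

/-- The random orbit `T_ω^n x`. -/
def orbit (ω : ℕ → Fin 2) (n : ℕ) (x : ℝ) : ℝ := (randomMap^[n] (ω, x)).2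

open Classical in
/-- The first sign of `(ω, x)`: it is `ω_1`, except at the countably many points where the two maps
coincide. There the sign does not depend on `ω` and is the one for which the affine branch
`y ↦ (-1)^s d (d - 1) y + (-1)^(s + 1) (d - 1 + s)` takes the value `T x = 1`, namely
`0` at `x = 1` and `1` at `x = 1 / n`, `n ≥ 2`. -/
def firstSign (z : (ℕ → Fin 2) × ℝ) : Fin 2 :=
  if z.2 = 1 then 0
  else if IsPartitionPoint z.2 then 1
  else z.1 0

/-- The first digit of `x ∈ (0,1]`: it is `2` at `x = 1`, and `n ≥ 2` when
`1 / n ≤ x < 1 / (n - 1)`, that is, `n = ⌈1 / x⌉`. -/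
def firstDigit (x : ℝ) : ℕ := if x = 1 then 2 else ⌈1 / x⌉₊

/-- The sequence of signs and digits produced by the random Lueroth transformation
(entry `n` is `(s_{n+1}(ω, x), d_{n+1}(ω, x))`). -/
def expansion (ω : ℕ → Fin 2) (x : ℝ) (n : ℕ) : Fin 2 × ℕ :=
  (firstSign (randomMap^[n] (ω, x)), firstDigit (orbit ω n x))

/-- The term with index `n + 1` of the generalised Lueroth series of a sequence of signs and
digits. -/
def seriesTerm (a : ℕ → Fin 2 × ℕ) (n : ℕ) : ℝ :=
  (-1 : ℝ) ^ (∑ i ∈ Finset.range n, ((a i).1 : ℕ)) *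
    ((((a n).2 : ℝ) - 1 + (((a n).1 : ℕ) : ℝ)) /
      ∏ i ∈ Finset.range (n + 1), ((a i).2 : ℝ) * (((a i).2 : ℝ) - 1))

/-- The sequence `a` of signs and digits is a generalised Lueroth expansion of `x`. -/
def IsExpansionOf (a : ℕ → Fin 2 × ℕ) (x : ℝ) : Prop :=
  (∀ n, 2 ≤ (a n).2) ∧ HasSum (seriesTerm a) x

/-- Every finite block of signs and digits `≥ 2` occurs in the sequence `a`. -/
def IsUniversal (a : ℕ → Fin 2 × ℕ) : Prop :=
  ∀ b : List (Fin 2 × ℕ), (∀ c ∈ b, 2 ≤ c.2) →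
    ∃ k : ℕ, ∀ (i : ℕ) (hi : i < b.length), a (k + i) = b[i]

/-- The `n`-th convergent `p_n / q_n` of `(ω, x)`. -/
def convergent (ω : ℕ → Fin 2) (x : ℝ) (n : ℕ) : ℝ :=
  ∑ k ∈ Finset.range n, seriesTerm (expansion ω x) k

/-- The number `q_{n+1} = (d_{n+1} - s_{n+1}) ∏_{i ≤ n} d_i (d_i - 1)`. -/
def denom (ω : ℕ → Fin 2) (x : ℝ) (n : ℕ) : ℝ :=
  (((expansion ω x n).2 : ℝ) - (((expansion ω x n).1 : ℕ) : ℝ)) *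
    ∏ i ∈ Finset.range n, ((expansion ω x i).2 : ℝ) * (((expansion ω x i).2 : ℝ) - 1)

/-- The approximation coefficient `θ_{n+1}(ω, x) = q_{n+1} |x - p_{n+1} / q_{n+1}|`. -/
def theta (ω : ℕ → Fin 2) (x : ℝ) (n : ℕ) : ℝ :=
  denom ω x n * |x - convergent ω x (n + 1)|

/-- `lim (1 / n) log |x - p_n / q_n|` exists and equals `r`. -/
def HasRate (ω : ℕ → Fin 2) (x r : ℝ) : Prop :=
  Tendsto (fun n : ℕ => 1 / (n : ℝ) * Real.log |x - convergent ω x n|) atTop (𝓝 r)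

/-- The pointwise Lyapunov exponent `lim (1 / n) log |d/dx T_ω^n x|` of `(ω, x)` is defined and
equals `l`; the derivatives are those of maps on `[0,1]`. -/
def HasLyapunovExponent (ω : ℕ → Fin 2) (x l : ℝ) : Prop :=
  ∃ D : ℕ → ℝ, (∀ n, HasDerivWithinAt (orbit ω n) (D n) (Icc 0 1) x) ∧
    Tendsto (fun n : ℕ => 1 / (n : ℝ) * Real.log |D n|) atTop (𝓝 l)

/-- The `(p, 1 - p)`-Bernoulli measure `m_p` on `{0,1}^ℕ`. -/
def bernoulliSeq (p : unitInterval) : Measure (ℕ → Fin 2) :=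
  Measure.infinitePi fun _ : ℕ => ProbabilityTheory.bernoulliMeasure (0 : Fin 2) 1 p

/-- The measure `m_p × λ`, with `λ` the Lebesgue measure on `[0,1]`. -/
def productMeasure (p : unitInterval) : Measure ((ℕ → Fin 2) × ℝ) :=
  (bernoulliSeq p).prod (volume.restrict (Icc (0 : ℝ) 1))

/-- The value `∑_{d ≥ 2} log (d (d - 1)) / (d (d - 1))`. -/
def typicalExponent : ℝ :=
  ∑' k : ℕ, Real.log (((k : ℝ) + 2) * ((k : ℝ) + 1)) / (((k : ℝ) + 2) * ((k : ℝ) + 1))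

/-- The limiting distribution function `F_L` of the approximation coefficients of `T_L`, for
`0 < z ≤ 1`. -/
def distL (z : ℝ) : ℝ :=
  (∑ k ∈ Finset.Icc 2 (⌊1 / z⌋₊ + 1), z / (k : ℝ)) + 1 / ((⌊1 / z⌋₊ : ℝ) + 1)

/-- The limiting distribution function `F_A` of the approximation coefficients of `T_A`, for
`0 < z ≤ 1`. -/
def distA (z : ℝ) : ℝ :=
  (∑ k ∈ Finset.Icc 2 ⌊1 / z⌋₊, z / ((k : ℝ) - 1)) + 1 / (⌊1 / z⌋₊ : ℝ)

/-- The first moment `M_L` of `F_L`. -/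
def momentL : ℝ := ∫ z in Icc (0 : ℝ) 1, (1 - distL z)

/-- The first moment `M_A` of `F_A`. -/
def momentA : ℝ := ∫ z in Icc (0 : ℝ) 1, (1 - distA z)

/-- The value `M_p = p (2 ζ(2) - 3) / 2 + (2 - ζ(2)) / 2`. -/
def meanTheta (p : ℝ) : ℝ :=
  p * ((2 * (riemannZeta 2).re - 3) / 2) + (2 - (riemannZeta 2).re) / 2

end RandomLuroth

end

namespace RandomLuroth

/-! Everything rests on one identity: each `y` in `(0,1]` is `branchOffset c + branchSlope c * T y`,
where `c` is its first sign and digit (`firstPair_spec`). Iterating it gives the series, the error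
`|x - p_n/q_n| = T^n x / ∏ d_i (d_i - 1)`, and `theta` as a function of one pair times the next
orbit point (`abs_sub_convergent`, `theta_eq`).

Rates: `|(T^n)'|` is `∏ d_i (d_i - 1)` whenever all iterates are differentiable, because
differentiability keeps the orbit of an interior point away from the jumps `1/n` (the end point `1`
is treated separately). The digit bounds `T^n x` from below, so its logarithm is negligible once the
averages of `log (d_i (d_i - 1))` converge. Every factor is at least `2`, which bounds the spectra;
mixing the digits `2` and `D` with a prescribed frequency in alternating expansions attains every
admissible value.

Typical behaviour: each branch maps its cylinder affinely onto the whole space, so the product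
measure is invariant and the first pair is independent of the image point
(`measure_firstPair_inter_preimage_singleton`). Hence the pairs obey the strong law, which gives the
exponent. The coefficients `theta` depend on the whole future and are not independent; subtracting
from the pair factor its mean makes the terms orthogonal, and a law of large numbers for bounded
orthogonal sequences applies (`ae_tendsto_average_centred`). Used in the one-step identity, it also
gives the average `1/2` of the orbit, so no ergodic theorem is needed.

Universality follows because a set of points that avoid a block of positive weight must lose a fixed
proportion of its own measure. Uncountability follows from Fubini, since the Bernoulli measure has
no atoms. The moments are computed by writing `1 - F` as a mixture of hat functions. -/

/-! ### The branches of the maps and the one-step identity -/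

/-- `x` lies in the open interval `(1 / n, 1 / (n - 1))`. -/
def InCell (n : ℕ) (x : ℝ) : Prop := 2 ≤ n ∧ 1 < n * x ∧ ((n : ℝ) - 1) * x < 1

lemma two_le_cast {n : ℕ} (h : 2 ≤ n) : (2 : ℝ) ≤ n := by exact_mod_cast h

lemma isPartitionPoint_one : IsPartitionPoint 1 := ⟨1, le_rfl, by simp⟩

lemma InCell.pos {n : ℕ} {x : ℝ} (h : InCell n x) : 0 < x := by
  obtain ⟨h2, h3, -⟩ := h
  have := two_le_cast h2
  by_contra hx
  push Not at hx
  nlinarith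

lemma InCell.ceil {n : ℕ} {x : ℝ} (h : InCell n x) : ⌈1 / x⌉ = (n : ℤ) := by
  have hx := h.pos
  obtain ⟨h2, h3, h4⟩ := h
  rw [Int.ceil_eq_iff]
  constructor
  · rw [lt_div_iff₀ hx]; push_cast; linarith
  · rw [div_le_iff₀ hx]; push_cast; linarith

lemma InCell.lt_one {n : ℕ} {x : ℝ} (h : InCell n x) : x < 1 := by
  have hx := h.pos
  obtain ⟨h2, h3, h4⟩ := h
  have := two_le_cast h2
  nlinarith

lemma InCell.not_isPartitionPoint {n : ℕ} {x : ℝ} (h : InCell n x) : ¬ IsPartitionPoint x := by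
  rintro ⟨m, hm, rfl⟩
  obtain ⟨h2, h3, h4⟩ := h
  have hm' : (0 : ℝ) < m := by exact_mod_cast hm
  rw [mul_one_div, lt_div_iff₀ hm', one_mul] at h3
  rw [mul_one_div, div_lt_one hm'] at h4
  have h3' : m < n := by exact_mod_cast h3
  have h4' : n < m + 1 := by
    have : (n : ℝ) < m + 1 := by linarith
    exact_mod_cast this
  omega

lemma InCell.mapL {n : ℕ} {x : ℝ} (h : InCell n x) :
    mapL x = n * ((n : ℝ) - 1) * x - ((n : ℝ) - 1) := by
  rw [RandomLuroth.mapL, if_neg h.pos.ne', if_neg h.lt_one.ne, h.ceil]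
  push_cast
  ring

lemma InCell.mapT_zero {n : ℕ} {x : ℝ} (h : InCell n x) :
    mapT 0 x = n * ((n : ℝ) - 1) * x - ((n : ℝ) - 1) := by
  rw [mapT, if_neg (not_or.2 ⟨h.pos.ne', h.not_isPartitionPoint⟩), if_pos rfl, h.mapL]

lemma InCell.mapT_one {n : ℕ} {x : ℝ} (h : InCell n x) :
    mapT 1 x = n - n * ((n : ℝ) - 1) * x := by
  rw [mapT, if_neg (not_or.2 ⟨h.pos.ne', h.not_isPartitionPoint⟩), if_neg (by decide), mapA, h.mapL]
  ring

lemma InCell.mapT_mem {n : ℕ} {x : ℝ} (h : InCell n x) (j : Fin 2) : mapT j x ∈ Ioo (0 : ℝ) 1 := by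
  have h0 := h.mapT_zero
  have h1 := h.mapT_one
  obtain ⟨h2, h3, h4⟩ := h
  have := two_le_cast h2
  fin_cases j
  · simp only [Fin.zero_eta]; rw [h0]; constructor <;> nlinarith
  · simp only [Fin.mk_one]; rw [h1]; constructor <;> nlinarith

lemma InCell.firstDigit {n : ℕ} {x : ℝ} (h : InCell n x) : firstDigit x = n := by
  rw [RandomLuroth.firstDigit, if_neg h.lt_one.ne]
  have := h.ceil
  rw [← Int.ceil_toNat, this]
  simp

lemma InCell.firstSign {n : ℕ} {x : ℝ} (h : InCell n x) (ω : ℕ → Fin 2) :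
    firstSign (ω, x) = ω 0 := by
  simp only [RandomLuroth.firstSign]
  rw [if_neg h.lt_one.ne, if_neg h.not_isPartitionPoint]

lemma exists_inCell {x : ℝ} (hx : x ∈ Ioc (0 : ℝ) 1) (h : ¬ IsPartitionPoint x) :
    ∃ n, InCell n x := by
  have hpos := hx.1
  have h1 : x ≠ 1 := fun h1 => h (h1 ▸ isPartitionPoint_one)
  have hlt : x < 1 := lt_of_le_of_ne hx.2 h1
  have hinv : 1 < 1 / x := by rw [lt_div_iff₀ hpos]; linarith
  have hc : 1 < ⌈1 / x⌉₊ := by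
    rw [Nat.lt_ceil]; simpa using hinv
  refine ⟨⌈1 / x⌉₊, hc, ?_, ?_⟩
  · have hle : 1 / x ≤ ⌈1 / x⌉₊ := Nat.le_ceil _
    rw [div_le_iff₀ hpos] at hle
    refine lt_of_le_of_ne hle fun heq => h ⟨⌈1 / x⌉₊, by omega, ?_⟩
    have : ((⌈1 / x⌉₊ : ℕ) : ℝ) ≠ 0 := by
      intro h0; rw [h0] at heq; simp at heq
    rw [eq_div_iff this]; linarith
  · have := Nat.ceil_lt_add_one (a := 1 / x) (by positivity)
    have h2 : ((⌈1 / x⌉₊ : ℕ) : ℝ) - 1 < 1 / x := by linarith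
    rwa [lt_div_iff₀ hpos] at h2

lemma mapT_of_isPartitionPoint {x : ℝ} (h : IsPartitionPoint x) (j : Fin 2) : mapT j x = 1 := by
  rw [mapT, if_pos (Or.inr h)]

lemma firstDigit_one_div {n : ℕ} (h : 2 ≤ n) : firstDigit (1 / (n : ℝ)) = n := by
  have := two_le_cast h
  rw [firstDigit, if_neg]
  · simp
  · rw [div_eq_iff (by linarith)]; linarith

lemma firstSign_one_div {n : ℕ} (h : 2 ≤ n) (ω : ℕ → Fin 2) : firstSign (ω, 1 / (n : ℝ)) = 1 := by
  have := two_le_cast h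
  simp only [firstSign]
  rw [if_neg, if_pos ⟨n, by omega, rfl⟩]
  rw [div_eq_iff (by linarith)]; linarith

lemma mapT_mem_Ioc {x : ℝ} (hx : x ∈ Ioc (0 : ℝ) 1) (j : Fin 2) : mapT j x ∈ Ioc (0 : ℝ) 1 := by
  by_cases h : IsPartitionPoint x
  · rw [mapT_of_isPartitionPoint h]; simp
  · obtain ⟨n, hn⟩ := exists_inCell hx h
    exact Ioo_subset_Ioc_self (hn.mapT_mem j)

/-- The first sign and digit of `(ω, x)`. -/
noncomputable def firstPair (z : (ℕ → Fin 2) × ℝ) : Fin 2 × ℕ := (firstSign z, firstDigit z.2)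

/-- The modulus `d (d - 1)` of the slope of the branch with a given sign and digit. -/
def expansionFactor (c : Fin 2 × ℕ) : ℝ := (c.2 : ℝ) * ((c.2 : ℝ) - 1)

/-- The value at `0` of the inverse branch with a given sign and digit. -/
noncomputable def branchOffset (c : Fin 2 × ℕ) : ℝ :=
  ((c.2 : ℝ) - 1 + ((c.1 : ℕ) : ℝ)) / expansionFactor c

/-- The slope of the inverse branch with a given sign and digit. -/
noncomputable def branchSlope (c : Fin 2 × ℕ) : ℝ := (-1) ^ (c.1 : ℕ) / expansionFactor c

/-- The factor `q_n / ∏_{i ≤ n} d_i (d_i - 1)` in the approximation coefficient. -/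
noncomputable def thetaFactor (c : Fin 2 × ℕ) : ℝ :=
  ((c.2 : ℝ) - ((c.1 : ℕ) : ℝ)) / expansionFactor c

lemma two_le_expansionFactor {c : Fin 2 × ℕ} (h : 2 ≤ c.2) : 2 ≤ expansionFactor c := by
  have := two_le_cast h
  rw [expansionFactor]; nlinarith

lemma expansionFactor_pos {c : Fin 2 × ℕ} (h : 2 ≤ c.2) : 0 < expansionFactor c := by
  linarith [two_le_expansionFactor h]

/-- On a cell this inverts an affine branch; at `1/n` it holds because the conventional sign is the
one whose branch takes the value `1`. The bound `1 ≤ d * x` is what later controls small orbit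
points. -/
lemma firstPair_spec (ω : ℕ → Fin 2) {x : ℝ} (hx : x ∈ Ioc (0 : ℝ) 1) :
    2 ≤ firstDigit x ∧ 1 ≤ firstDigit x * x ∧
      x = branchOffset (firstPair (ω, x)) + branchSlope (firstPair (ω, x)) * mapT (ω 0) x := by
  by_cases h : IsPartitionPoint x
  · rw [mapT_of_isPartitionPoint h]
    obtain ⟨n, hn, rfl⟩ := h
    rcases Nat.lt_or_ge n 2 with h2 | h2
    · obtain rfl : n = 1 := by omega
      simp [firstPair, firstDigit, firstSign, branchOffset, branchSlope, expansionFactor]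
      norm_num
    · have := two_le_cast h2
      have h0 : (n : ℝ) ≠ 0 := by linarith
      have h1 : (n : ℝ) - 1 ≠ 0 := by linarith
      rw [firstPair, firstSign_one_div h2, firstDigit_one_div h2]
      refine ⟨h2, ?_, ?_⟩
      · rw [mul_one_div_cancel h0]
      · simp [branchOffset, branchSlope, expansionFactor]
        field_simp
        ring
  · obtain ⟨n, hn⟩ := exists_inCell hx h
    have h2 := two_le_cast hn.1
    have h0 : (n : ℝ) ≠ 0 := by linarith
    have h1 : (n : ℝ) - 1 ≠ 0 := by linarith
    rw [firstPair, hn.firstSign, hn.firstDigit]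
    refine ⟨hn.1, hn.2.1.le, ?_⟩
    rcases Fin.exists_fin_two.1 ⟨ω 0, rfl⟩ with h3 | h3
    · rw [h3, hn.mapT_zero]
      simp [branchOffset, branchSlope, expansionFactor]
      field_simp
      ring
    · rw [h3, hn.mapT_one]
      simp [branchOffset, branchSlope, expansionFactor]
      field_simp
      ring

/-! ### Orbits, the series and the approximation error -/

lemma iterate_randomMap_fst (ω : ℕ → Fin 2) (x : ℝ) (n : ℕ) :
    (randomMap^[n] (ω, x)).1 = fun i => ω (n + i) := by
  induction n with
  | zero => simp
  | succ n ih =>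
    rw [Function.iterate_succ_apply', randomMap, ih]
    ext i; simp; congr 2; ring

lemma orbit_zero (ω : ℕ → Fin 2) (x : ℝ) : orbit ω 0 x = x := rfl

lemma orbit_succ (ω : ℕ → Fin 2) (x : ℝ) (n : ℕ) :
    orbit ω (n + 1) x = mapT (ω n) (orbit ω n x) := by
  rw [orbit, Function.iterate_succ_apply', randomMap, iterate_randomMap_fst]
  rfl

lemma iterate_randomMap (ω : ℕ → Fin 2) (x : ℝ) (n : ℕ) :
    randomMap^[n] (ω, x) = (fun i => ω (n + i), orbit ω n x) :=
  Prod.ext (iterate_randomMap_fst ω x n) rfl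

lemma expansion_eq (ω : ℕ → Fin 2) (x : ℝ) (n : ℕ) :
    expansion ω x n = firstPair (randomMap^[n] (ω, x)) := rfl

lemma orbit_mem {ω : ℕ → Fin 2} {x : ℝ} (hx : x ∈ Ioc (0 : ℝ) 1) (n : ℕ) :
    orbit ω n x ∈ Ioc (0 : ℝ) 1 := by
  induction n with
  | zero => exact hx
  | succ n ih => rw [orbit_succ]; exact mapT_mem_Ioc ih _

lemma two_le_expansion {ω : ℕ → Fin 2} {x : ℝ} (hx : x ∈ Ioc (0 : ℝ) 1) (n : ℕ) :
    2 ≤ (expansion ω x n).2 := by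
  rw [expansion_eq, iterate_randomMap]
  exact (firstPair_spec ω (orbit_mem hx n)).1

lemma one_le_digit_mul_orbit {ω : ℕ → Fin 2} {x : ℝ} (hx : x ∈ Ioc (0 : ℝ) 1) (n : ℕ) :
    1 ≤ (expansion ω x n).2 * orbit ω n x := by
  rw [expansion_eq, iterate_randomMap]
  exact (firstPair_spec ω (orbit_mem hx n)).2.1

lemma orbit_eq {ω : ℕ → Fin 2} {x : ℝ} (hx : x ∈ Ioc (0 : ℝ) 1) (n : ℕ) :
    orbit ω n x = branchOffset (expansion ω x n) +
      branchSlope (expansion ω x n) * orbit ω (n + 1) x := by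
  rw [orbit_succ, expansion_eq, iterate_randomMap]
  exact (firstPair_spec _ (orbit_mem hx n)).2.2

/-- A term of the series as an offset times a product of slopes. -/
lemma seriesTerm_eq (a : ℕ → Fin 2 × ℕ) (n : ℕ) :
    seriesTerm a n = (∏ i ∈ Finset.range n, branchSlope (a i)) * branchOffset (a n) := by
  simp only [seriesTerm, branchSlope, branchOffset, expansionFactor]
  rw [Finset.prod_div_distrib, Finset.prod_pow_eq_pow_sum, Finset.prod_range_succ]
  rw [div_mul_div_comm, mul_div_assoc]

/-- The one-step identity unrolled: the remainder is the current orbit point carried back through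
the linear parts of `n` inverse branches. -/
lemma sub_convergent {ω : ℕ → Fin 2} {x : ℝ} (hx : x ∈ Ioc (0 : ℝ) 1) (n : ℕ) :
    x - convergent ω x n =
      (∏ i ∈ Finset.range n, branchSlope (expansion ω x i)) * orbit ω n x := by
  induction n with
  | zero => simp [convergent, orbit_zero]
  | succ n ih =>
    rw [convergent, Finset.sum_range_succ, ← convergent, ← sub_sub, ih, seriesTerm_eq,
      Finset.prod_range_succ, orbit_eq hx n]
    ring

lemma abs_branchSlope (c : Fin 2 × ℕ) (h : 2 ≤ c.2) : |branchSlope c| = 1 / expansionFactor c := by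
  rw [branchSlope, abs_div, abs_neg_one_pow, abs_of_pos (expansionFactor_pos h)]

lemma abs_sub_convergent {ω : ℕ → Fin 2} {x : ℝ} (hx : x ∈ Ioc (0 : ℝ) 1) (n : ℕ) :
    |x - convergent ω x n| =
      orbit ω n x / ∏ i ∈ Finset.range n, expansionFactor (expansion ω x i) := by
  rw [sub_convergent hx, abs_mul, Finset.abs_prod, abs_of_pos (orbit_mem hx n).1,
    Finset.prod_congr rfl fun i _ => abs_branchSlope _ (two_le_expansion hx i),
    Finset.prod_div_distrib]
  simp [div_eq_inv_mul]

/-- The first `n` factors of `q_{n+1}` cancel against the error, so only the last pair and the next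
orbit point survive. -/
lemma theta_eq {ω : ℕ → Fin 2} {x : ℝ} (hx : x ∈ Ioc (0 : ℝ) 1) (n : ℕ) :
    theta ω x n = thetaFactor (expansion ω x n) * orbit ω (n + 1) x := by
  rw [theta, abs_sub_convergent hx, denom, thetaFactor, Finset.prod_range_succ]
  have h1 : expansionFactor (expansion ω x n) ≠ 0 :=
    (expansionFactor_pos (two_le_expansion hx n)).ne'
  have h2 : ∏ i ∈ Finset.range n, expansionFactor (expansion ω x i) ≠ 0 :=
    Finset.prod_ne_zero_iff.2 fun i _ => (expansionFactor_pos (two_le_expansion hx i)).ne'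
  change _ * (∏ i ∈ Finset.range n, expansionFactor (expansion ω x i)) * _ = _
  field_simp

lemma abs_branchSlope_le {c : Fin 2 × ℕ} (h : 2 ≤ c.2) : |branchSlope c| ≤ 1 / 2 := by
  rw [abs_branchSlope c h]
  exact one_div_le_one_div_of_le two_pos (two_le_expansionFactor h)

lemma fin_two_cast_mem (s : Fin 2) : ((s : ℕ) : ℝ) ∈ Icc (0 : ℝ) 1 := by
  have : (s : ℕ) ≤ 1 := by omega
  exact ⟨by positivity, by exact_mod_cast this⟩

lemma branchOffset_mem {c : Fin 2 × ℕ} (h : 2 ≤ c.2) : branchOffset c ∈ Icc (0 : ℝ) 1 := by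
  have h1 := two_le_cast h
  have h2 := fin_two_cast_mem c.1
  have h3 := expansionFactor_pos h
  refine ⟨div_nonneg (by linarith [h2.1]) h3.le, ?_⟩
  rw [branchOffset, div_le_one h3, expansionFactor]
  nlinarith [h2.2]

lemma thetaFactor_mem {c : Fin 2 × ℕ} (h : 2 ≤ c.2) : thetaFactor c ∈ Icc (0 : ℝ) 1 := by
  have h1 := two_le_cast h
  have h2 := fin_two_cast_mem c.1
  have h3 := expansionFactor_pos h
  refine ⟨div_nonneg (by linarith [h2.2]) h3.le, ?_⟩
  rw [thetaFactor, div_le_one h3, expansionFactor]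
  nlinarith [h2.1]

lemma abs_prod_branchSlope_le {a : ℕ → Fin 2 × ℕ} (h : ∀ n, 2 ≤ (a n).2) (n : ℕ) :
    |∏ i ∈ Finset.range n, branchSlope (a i)| ≤ (1 / 2) ^ n := by
  rw [Finset.abs_prod]
  calc _ ≤ ∏ i ∈ Finset.range n, (1 / 2 : ℝ) :=
        Finset.prod_le_prod (fun _ _ => abs_nonneg _) fun i _ => abs_branchSlope_le (h i)
    _ = _ := by simp

lemma summable_seriesTerm {a : ℕ → Fin 2 × ℕ} (h : ∀ n, 2 ≤ (a n).2) :
    Summable (seriesTerm a) := by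
  refine Summable.of_norm_bounded (g := fun n => (1 / 2 : ℝ) ^ n) summable_geometric_two fun n => ?_
  rw [seriesTerm_eq, norm_mul]
  have h1 := branchOffset_mem (h n)
  have h2 := abs_prod_branchSlope_le h n
  rw [Real.norm_eq_abs, Real.norm_eq_abs, abs_of_nonneg h1.1]
  calc _ ≤ (1 / 2 : ℝ) ^ n * 1 := mul_le_mul h2 h1.2 h1.1 (by positivity)
    _ = _ := mul_one _

lemma tendsto_sub_convergent {ω : ℕ → Fin 2} {x : ℝ} (hx : x ∈ Ioc (0 : ℝ) 1) :
    Tendsto (fun n => x - convergent ω x n) atTop (𝓝 0) := by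
  refine squeeze_zero_norm (a := fun n => (1 / 2 : ℝ) ^ n) (fun n => ?_)
    (tendsto_pow_atTop_nhds_zero_of_lt_one (by norm_num) (by norm_num))
  rw [sub_convergent hx, norm_mul, Real.norm_eq_abs, Real.norm_eq_abs]
  have h1 := orbit_mem (ω := ω) hx n
  rw [abs_of_pos h1.1]
  calc _ ≤ (1 / 2 : ℝ) ^ n * 1 :=
        mul_le_mul (abs_prod_branchSlope_le (two_le_expansion hx) n) h1.2 h1.1.le (by positivity)
    _ = _ := mul_one _

/-- The random Lueroth transformation produces generalised Lueroth expansions. -/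
lemma isExpansionOf_expansion (ω : ℕ → Fin 2) {x : ℝ} (hx : x ∈ Ioc (0 : ℝ) 1) :
    IsExpansionOf (expansion ω x) x := by
  refine ⟨two_le_expansion hx, ?_⟩
  rw [(summable_seriesTerm (two_le_expansion hx)).hasSum_iff_tendsto_nat]
  have := (tendsto_sub_convergent (ω := ω) hx).const_sub x
  simpa [convergent] using this

/-! ### Averages of log factors and the rate of convergence -/

/-- The sum of the logarithms of the first `n` expansion factors. -/
noncomputable def logFactorSum (ω : ℕ → Fin 2) (x : ℝ) (n : ℕ) : ℝ :=
  ∑ i ∈ Finset.range n, Real.log (expansionFactor (expansion ω x i))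

lemma log_prod_expansionFactor {ω : ℕ → Fin 2} {x : ℝ} (hx : x ∈ Ioc (0 : ℝ) 1) (n : ℕ) :
    Real.log (∏ i ∈ Finset.range n, expansionFactor (expansion ω x i)) = logFactorSum ω x n :=
  Real.log_prod fun i _ => (expansionFactor_pos (two_le_expansion hx i)).ne'

lemma log_abs_sub_convergent {ω : ℕ → Fin 2} {x : ℝ} (hx : x ∈ Ioc (0 : ℝ) 1) (n : ℕ) :
    Real.log |x - convergent ω x n| = Real.log (orbit ω n x) - logFactorSum ω x n := by
  rw [abs_sub_convergent hx, Real.log_div (orbit_mem hx n).1.ne', log_prod_expansionFactor hx]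
  exact Finset.prod_ne_zero_iff.2 fun i _ => (expansionFactor_pos (two_le_expansion hx i)).ne'

lemma log_orbit_nonpos {ω : ℕ → Fin 2} {x : ℝ} (hx : x ∈ Ioc (0 : ℝ) 1) (n : ℕ) :
    Real.log (orbit ω n x) ≤ 0 :=
  Real.log_nonpos (orbit_mem hx n).1.le (orbit_mem hx n).2

/-- From `1 ≤ d * y` and `d ≤ d (d - 1)`. The bound is written as a difference of consecutive sums
so that, after division by `n`, it tends to `0` when the averages converge. -/
lemma neg_log_factor_le_log_orbit {ω : ℕ → Fin 2} {x : ℝ} (hx : x ∈ Ioc (0 : ℝ) 1) (n : ℕ) :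
    logFactorSum ω x n - logFactorSum ω x (n + 1) ≤ Real.log (orbit ω n x) := by
  have h1 := one_le_digit_mul_orbit (ω := ω) hx n
  have h2 := two_le_expansion (ω := ω) hx n
  have h3 := expansionFactor_pos h2
  have h4 := (orbit_mem (ω := ω) hx n).1
  have h5 := two_le_cast h2
  rw [logFactorSum, logFactorSum, Finset.sum_range_succ, sub_add_cancel_left, neg_le_iff_add_nonneg,
    ← Real.log_mul h4.ne' h3.ne']
  apply Real.log_nonneg
  rw [expansionFactor]
  nlinarith

lemma mul_log_two_le_logFactorSum {ω : ℕ → Fin 2} {x : ℝ} (hx : x ∈ Ioc (0 : ℝ) 1) (n : ℕ) :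
    n * Real.log 2 ≤ logFactorSum ω x n := by
  have : ∑ i ∈ Finset.range n, Real.log 2 ≤ logFactorSum ω x n :=
    Finset.sum_le_sum fun i _ =>
      Real.log_le_log two_pos (two_le_expansionFactor (two_le_expansion hx i))
  simpa using this

/-- If the averages of the logarithms of the expansion factors converge, so does the rate. -/
lemma hasRate_of_tendsto {ω : ℕ → Fin 2} {x l : ℝ} (hx : x ∈ Ioc (0 : ℝ) 1)
    (h : Tendsto (fun n : ℕ => 1 / (n : ℝ) * logFactorSum ω x n) atTop (𝓝 l)) :
    HasRate ω x (-l) := by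
  have hsucc : Tendsto (fun n : ℕ => 1 / (n : ℝ) * logFactorSum ω x (n + 1)) atTop (𝓝 l) := by
    have h1 := (tendsto_add_atTop_iff_nat 1).2 h
    have h2 : Tendsto (fun n : ℕ => 1 + 1 / (n : ℝ)) atTop (𝓝 (1 + 0)) :=
      tendsto_const_nhds.add tendsto_one_div_atTop_nhds_zero_nat
    have h3 := h2.mul h1
    rw [add_zero, one_mul] at h3
    refine h3.congr' ?_
    filter_upwards [eventually_ge_atTop 1] with n hn
    have : (n : ℝ) ≠ 0 := by positivity
    push_cast
    field_simp
  -- The orbit term is squeezed between `0` and a difference of two sequences with the same limit.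
  have hlog : Tendsto (fun n : ℕ => 1 / (n : ℝ) * Real.log (orbit ω n x)) atTop (𝓝 0) := by
    have h1 := h.sub hsucc
    rw [sub_self] at h1
    refine tendsto_of_tendsto_of_tendsto_of_le_of_le h1 tendsto_const_nhds (fun n => ?_)
      (fun n => ?_)
    · rw [← mul_sub]
      exact mul_le_mul_of_nonneg_left (neg_log_factor_le_log_orbit hx n) (by positivity)
    · exact mul_nonpos_of_nonneg_of_nonpos (by positivity) (log_orbit_nonpos hx n)
  have h2 := hlog.sub h
  rw [zero_sub] at h2
  refine h2.congr fun n => ?_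
  rw [log_abs_sub_convergent hx, mul_sub]

lemma rate_le {ω : ℕ → Fin 2} {x r : ℝ} (hx : x ∈ Ioc (0 : ℝ) 1) (h : HasRate ω x r) :
    r ≤ -Real.log 2 := by
  refine le_of_tendsto h ?_
  filter_upwards [eventually_ge_atTop 1] with n hn
  have hn' : (0 : ℝ) < n := by exact_mod_cast hn
  rw [log_abs_sub_convergent hx, one_div, inv_mul_le_iff₀ hn']
  linarith [log_orbit_nonpos (ω := ω) hx n, mul_log_two_le_logFactorSum (ω := ω) hx n]

lemma le_of_tendsto_logFactorSum {ω : ℕ → Fin 2} {x l : ℝ} (hx : x ∈ Ioc (0 : ℝ) 1)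
    (h : Tendsto (fun n : ℕ => 1 / (n : ℝ) * logFactorSum ω x n) atTop (𝓝 l)) :
    Real.log 2 ≤ l := by
  refine ge_of_tendsto h ?_
  filter_upwards [eventually_ge_atTop 1] with n hn
  have hn' : (0 : ℝ) < n := by exact_mod_cast hn
  rw [one_div, le_inv_mul_iff₀ hn']
  exact mul_log_two_le_logFactorSum hx n

/-! ### Derivatives of the iterates -/

lemma InCell.eventually {n : ℕ} {x : ℝ} (h : InCell n x) : ∀ᶠ u in 𝓝 x, InCell n u := by
  obtain ⟨h2, h3, h4⟩ := h
  have e1 : ∀ᶠ u in 𝓝 x, 1 < (n : ℝ) * u :=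
    (continuous_const.mul continuous_id).continuousAt.eventually_const_lt h3
  have e2 : ∀ᶠ u in 𝓝 x, ((n : ℝ) - 1) * u < 1 :=
    (continuous_const.mul continuous_id).continuousAt.eventually_lt_const h4
  filter_upwards [e1, e2] with u hu1 hu2 using ⟨h2, hu1, hu2⟩

/-- As long as the orbit of `x` avoids the points `1 / n`, the iterates are affine near `x`. -/
lemma orbit_eventuallyEq_affine {ω : ℕ → Fin 2} {x : ℝ} (hx : x ∈ Ioc (0 : ℝ) 1) (n : ℕ)
    (h : ∀ i < n, ¬ IsPartitionPoint (orbit ω i x)) :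
    ∃ A B : ℝ, |A| = ∏ i ∈ Finset.range n, expansionFactor (expansion ω x i) ∧
      ∀ᶠ u in 𝓝 x, orbit ω n u = A * u + B := by
  induction n with
  | zero => exact ⟨1, 0, by simp, by simp [orbit_zero]⟩
  | succ n ih =>
    obtain ⟨A, B, hA, hAB⟩ := ih fun i hi => h i (by omega)
    obtain ⟨k, hk⟩ := exists_inCell (orbit_mem hx n) (h n (by omega))
    have hcell : ∀ᶠ u in 𝓝 x, InCell k (A * u + B) := by
      have hc : Tendsto (fun u => A * u + B) (𝓝 x) (𝓝 (A * x + B)) := by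
        apply Continuous.tendsto; fun_prop
      rw [← hAB.self_of_nhds] at hc
      exact hc.eventually hk.eventually
    have hk2 := two_le_cast hk.1
    have hfac : expansionFactor (expansion ω x n) = k * ((k : ℝ) - 1) := by
      rw [expansion_eq, iterate_randomMap, expansionFactor, firstPair, hk.firstDigit]
    rw [Finset.prod_range_succ, hfac, ← hA]
    have hpos : 0 ≤ (k : ℝ) * ((k : ℝ) - 1) := by nlinarith
    rcases Fin.exists_fin_two.1 ⟨ω n, rfl⟩ with h0 | h0
    · refine ⟨A * (k * ((k : ℝ) - 1)), k * ((k : ℝ) - 1) * B - ((k : ℝ) - 1), ?_, ?_⟩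
      · rw [abs_mul, abs_of_nonneg hpos]
      · filter_upwards [hAB, hcell] with u hu hc
        rw [orbit_succ, hu, h0, hc.mapT_zero]
        ring
    · refine ⟨-(A * (k * ((k : ℝ) - 1))), k - k * ((k : ℝ) - 1) * B, ?_, ?_⟩
      · rw [abs_neg, abs_mul, abs_of_nonneg hpos]
      · filter_upwards [hAB, hcell] with u hu hc
        rw [orbit_succ, hu, h0, hc.mapT_one]
        ring

lemma uniqueDiffWithinAt_unit {x : ℝ} (hx : x ∈ Ioc (0 : ℝ) 1) :
    UniqueDiffWithinAt ℝ (Icc 0 1) x :=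
  uniqueDiffOn_Icc one_pos x (Ioc_subset_Icc_self hx)

lemma exists_hasDerivWithinAt {ω : ℕ → Fin 2} {x : ℝ} (hx : x ∈ Ioc (0 : ℝ) 1) (n : ℕ)
    (h : ∀ i < n, ¬ IsPartitionPoint (orbit ω i x)) :
    ∃ A : ℝ, |A| = ∏ i ∈ Finset.range n, expansionFactor (expansion ω x i) ∧
      HasDerivWithinAt (orbit ω n) A (Icc 0 1) x := by
  obtain ⟨A, B, hA, hAB⟩ := orbit_eventuallyEq_affine hx n h
  refine ⟨A, hA, HasDerivAt.hasDerivWithinAt ?_⟩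
  have : HasDerivAt (fun u => A * u + B) A x := by
    simpa using ((hasDerivAt_id x).const_mul A).add_const B
  exact this.congr_of_eventuallyEq hAB

/-- The Lyapunov exponent along an orbit that avoids the points `1 / n`. -/
lemma hasLyapunovExponent_of_tendsto {ω : ℕ → Fin 2} {x l : ℝ} (hx : x ∈ Ioc (0 : ℝ) 1)
    (h : ∀ i, ¬ IsPartitionPoint (orbit ω i x))
    (hl : Tendsto (fun n : ℕ => 1 / (n : ℝ) * logFactorSum ω x n) atTop (𝓝 l)) :
    HasLyapunovExponent ω x l := by
  choose D hD hD' using fun n => exists_hasDerivWithinAt hx n fun i _ => h i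
  refine ⟨D, hD', hl.congr fun n => ?_⟩
  rw [hD, log_prod_expansionFactor hx]

/-- Just left of `1/k` lies the cell of digit `k + 1`, where the decreasing branch ends at `0`,
while the value at `1/k` is `1`. Together with `tendsto_mapT_zero` this gives a jump of both maps at
every `1/k`, `k ≥ 2`. -/
lemma tendsto_mapT_one {k : ℕ} (hk : 1 ≤ k) :
    Tendsto (mapT 1) (𝓝[<] (1 / (k : ℝ))) (𝓝 0) := by
  have hk' : (1 : ℝ) ≤ k := by exact_mod_cast hk
  have hk0 : (0 : ℝ) < k := by linarith
  have hc : Tendsto (fun u : ℝ => ((k + 1 : ℕ) : ℝ) - ((k + 1 : ℕ) : ℝ) * (((k + 1 : ℕ) : ℝ) - 1) * u)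
      (𝓝[<] (1 / (k : ℝ))) (𝓝 0) := by
    have : Continuous (fun u : ℝ => ((k + 1 : ℕ) : ℝ) -
      ((k + 1 : ℕ) : ℝ) * (((k + 1 : ℕ) : ℝ) - 1) * u) := by fun_prop
    convert (this.tendsto (1 / (k : ℝ))).mono_left nhdsWithin_le_nhds using 2
    push_cast
    field_simp
    ring
  refine hc.congr' ?_
  have hlt : 1 / ((k : ℝ) + 1) < 1 / (k : ℝ) := one_div_lt_one_div_of_lt hk0 (by linarith)
  filter_upwards [Ioo_mem_nhdsLT hlt] with u hu
  have h1 := hu.1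
  have h2 := hu.2
  rw [div_lt_iff₀ (by linarith)] at h1
  rw [lt_div_iff₀ hk0] at h2
  refine (InCell.mapT_one ⟨by omega, ?_, ?_⟩).symm
  · push_cast; linarith
  · push_cast; linarith

lemma tendsto_mapT_zero {k : ℕ} (hk : 2 ≤ k) :
    Tendsto (mapT 0) (𝓝[>] (1 / (k : ℝ))) (𝓝 0) := by
  have hk' := two_le_cast hk
  have hk0 : (0 : ℝ) < k := by linarith
  have hc : Tendsto (fun u : ℝ => (k : ℝ) * ((k : ℝ) - 1) * u - ((k : ℝ) - 1))
      (𝓝[>] (1 / (k : ℝ))) (𝓝 0) := by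
    have : Continuous (fun u : ℝ => (k : ℝ) * ((k : ℝ) - 1) * u - ((k : ℝ) - 1)) := by fun_prop
    convert (this.tendsto (1 / (k : ℝ))).mono_left nhdsWithin_le_nhds using 2
    field_simp
    ring
  refine hc.congr' ?_
  have hlt : 1 / (k : ℝ) < 1 / ((k : ℝ) - 1) :=
    one_div_lt_one_div_of_lt (by linarith) (by linarith)
  filter_upwards [Ioo_mem_nhdsGT hlt] with u hu
  have h1 := hu.1
  have h2 := hu.2
  rw [div_lt_iff₀ hk0] at h1
  rw [lt_div_iff₀ (by linarith)] at h2
  exact (InCell.mapT_zero ⟨hk, by linarith, by linarith⟩).symm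

lemma not_tendsto_mapT_one_div {k : ℕ} (hk : 2 ≤ k) (j : Fin 2) :
    ¬ Tendsto (mapT j) (𝓝 (1 / (k : ℝ))) (𝓝 1) := by
  intro h
  rcases Fin.exists_fin_two.1 ⟨j, rfl⟩ with rfl | rfl
  · exact zero_ne_one (tendsto_nhds_unique (tendsto_mapT_zero hk) (h.mono_left nhdsWithin_le_nhds))
  · exact zero_ne_one (tendsto_nhds_unique (tendsto_mapT_one (by omega))
      (h.mono_left nhdsWithin_le_nhds))

/-- If all iterates are differentiable at an interior point, its orbit avoids the points `1 / n`. -/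
lemma not_isPartitionPoint_of_hasDerivWithinAt {ω : ℕ → Fin 2} {x : ℝ} (hx : x ∈ Ioo (0 : ℝ) 1)
    {D : ℕ → ℝ} (hD : ∀ n, HasDerivWithinAt (orbit ω n) (D n) (Icc 0 1) x) (n : ℕ) :
    ¬ IsPartitionPoint (orbit ω n x) := by
  induction n using Nat.strong_induction_on with
  | _ n ih =>
    intro hpart
    have hx' := Ioo_subset_Ioc_self hx
    obtain ⟨A, B, hA, hAB⟩ := orbit_eventuallyEq_affine hx' n ih
    have hA0 : A ≠ 0 := by
      rw [← abs_pos, hA]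
      exact Finset.prod_pos fun i _ => expansionFactor_pos (two_le_expansion hx' i)
    have hy := hAB.self_of_nhds
    have hcont : Tendsto (orbit ω (n + 1)) (𝓝 x) (𝓝 1) := by
      have h1 := ((hD (n + 1)).hasDerivAt (Icc_mem_nhds hx.1 hx.2)).continuousAt
      rwa [ContinuousAt, orbit_succ, mapT_of_isPartitionPoint hpart] at h1
    -- Before the first visit to a partition point the iterate is affine and invertible near `x`.
    -- Its inverse transports continuity of the next iterate at `x` to continuity of a single map at
    -- the orbit point.
    have hg : Tendsto (fun u => (u - B) / A) (𝓝 (orbit ω n x)) (𝓝 x) := by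
      have : Continuous (fun u => (u - B) / A) := by fun_prop
      convert this.tendsto (orbit ω n x) using 2
      rw [hy]
      field_simp
      ring
    have hback : ∀ᶠ u in 𝓝 (orbit ω n x), orbit ω n ((u - B) / A) = u := by
      filter_upwards [hg.eventually hAB] with u hu
      rw [hu]
      field_simp
      ring
    obtain ⟨k, hk, hk'⟩ := hpart
    rcases Nat.lt_or_ge k 2 with h2 | h2
    -- Reaching `1` from an interior point is impossible: a nonconstant affine iterate would exceed
    -- `1` nearby.
    · obtain rfl : k = 1 := by omega
      have hone : orbit ω n x = 1 := by simpa using hk'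
      have hle : ∀ᶠ u in 𝓝 (orbit ω n x), u ≤ 1 := by
        filter_upwards [hback, hg.eventually (Ioo_mem_nhds hx.1 hx.2)] with u hu hu'
        rw [← hu]
        exact (orbit_mem (Ioo_subset_Ioc_self hu') n).2
      rw [hone] at hle
      obtain ⟨u, hu1, hu2⟩ := (hle.filter_mono nhdsWithin_le_nhds).and
        (self_mem_nhdsWithin : Ioi (1 : ℝ) ∈ 𝓝[>] 1) |>.exists
      exact absurd hu1 (not_le.2 hu2)
    · refine not_tendsto_mapT_one_div h2 (ω n) ?_
      rw [← hk']
      refine (hcont.comp hg).congr' ?_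
      filter_upwards [hback] with u hu
      simp only [Function.comp]
      rw [orbit_succ, hu]

lemma orbit_one (ω : ℕ → Fin 2) (n : ℕ) : orbit ω n 1 = 1 := by
  induction n with
  | zero => rfl
  | succ n ih => rw [orbit_succ, ih, mapT_of_isPartitionPoint isPartitionPoint_one]

lemma expansion_one (ω : ℕ → Fin 2) (n : ℕ) : expansion ω 1 n = (0, 2) := by
  rw [expansion_eq, iterate_randomMap, orbit_one]
  simp [firstPair, firstSign, firstDigit]

/-- If all iterates are differentiable at the end point `1`, they are given by doubling there. -/
lemma orbit_eventuallyEq_one {ω : ℕ → Fin 2} {D : ℕ → ℝ}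
    (hD : ∀ n, HasDerivWithinAt (orbit ω n) (D n) (Icc 0 1) 1) (n : ℕ) :
    ∀ᶠ u in 𝓝[<] (1 : ℝ), orbit ω n u = 1 - 2 ^ n * (1 - u) := by
  induction n with
  | zero => simp [orbit_zero]
  | succ n ih =>
    have hto : Tendsto (fun u : ℝ => 1 - 2 ^ n * (1 - u)) (𝓝[<] 1) (𝓝[<] 1) := by
      refine tendsto_nhdsWithin_iff.2 ⟨?_, ?_⟩
      · have : Continuous (fun u : ℝ => 1 - 2 ^ n * (1 - u)) := by fun_prop
        convert (this.tendsto 1).mono_left nhdsWithin_le_nhds using 2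
        simp
      · filter_upwards [self_mem_nhdsWithin] with u hu
        have : 0 < (2 : ℝ) ^ n * (1 - u) := mul_pos (by positivity) (sub_pos.2 hu)
        simpa using this
    rcases Fin.exists_fin_two.1 ⟨ω n, rfl⟩ with h0 | h0
    · have hcell : ∀ᶠ v in 𝓝[<] (1 : ℝ), InCell 2 v := by
        filter_upwards [Ioo_mem_nhdsLT (show (1 / 2 : ℝ) < 1 by norm_num)] with v hv
        refine ⟨le_rfl, ?_, ?_⟩
        · push_cast; linarith [hv.1]
        · push_cast; linarith [hv.2]
      filter_upwards [ih, hto.eventually hcell] with u hu hc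
      rw [orbit_succ, hu, h0, hc.mapT_zero]
      push_cast
      ring
    -- A letter `1` would send points just left of `1` near `0`, against continuity of the iterate
    -- at its fixed point `1`.
    · exfalso
      have h1 : Tendsto (orbit ω (n + 1)) (𝓝[<] 1) (𝓝 1) := by
        have h2 := (hD (n + 1)).continuousWithinAt.tendsto
        rw [orbit_one] at h2
        refine h2.mono_left ?_
        rw [← nhdsWithin_Ioo_eq_nhdsLT (zero_lt_one' ℝ)]
        exact nhdsWithin_mono _ Ioo_subset_Icc_self
      have h3 := tendsto_mapT_one (le_refl 1)
      rw [Nat.cast_one, div_one] at h3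
      have h2 : Tendsto (orbit ω (n + 1)) (𝓝[<] 1) (𝓝 0) := by
        refine (h3.comp hto).congr' ?_
        filter_upwards [ih] with u hu
        simp only [Function.comp]
        rw [orbit_succ, hu, h0]
      exact zero_ne_one (tendsto_nhds_unique h2 h1)

lemma hasDerivWithinAt_one {ω : ℕ → Fin 2} {D : ℕ → ℝ}
    (hD : ∀ n, HasDerivWithinAt (orbit ω n) (D n) (Icc 0 1) 1) (n : ℕ) : D n = 2 ^ n := by
  have h1 : HasDerivWithinAt (orbit ω n) (D n) (Iio 1) 1 := by
    refine HasDerivWithinAt.mono_of_mem_nhdsWithin (hD n) ?_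
    filter_upwards [Ioo_mem_nhdsLT (zero_lt_one' ℝ)] with u hu using Ioo_subset_Icc_self hu
  have h2 : HasDerivWithinAt (fun u : ℝ => 1 - 2 ^ n * (1 - u)) (2 ^ n) (Iio 1) 1 := by
    have := (((hasDerivAt_id (1 : ℝ)).const_sub 1).const_mul ((2 : ℝ) ^ n)).const_sub 1
    simpa using this.hasDerivWithinAt
  have h3 : HasDerivWithinAt (orbit ω n) (2 ^ n) (Iio 1) 1 :=
    h2.congr_of_eventuallyEq (orbit_eventuallyEq_one hD n) (by simp [orbit_one])
  exact (uniqueDiffWithinAt_Iio 1).eq_deriv _ h1 h3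

/-- The Lyapunov exponent is the limit of the averages of the logarithms of the expansion
factors. -/
lemma tendsto_of_hasLyapunovExponent {ω : ℕ → Fin 2} {x l : ℝ} (hx : x ∈ Ioc (0 : ℝ) 1)
    (h : HasLyapunovExponent ω x l) :
    Tendsto (fun n : ℕ => 1 / (n : ℝ) * logFactorSum ω x n) atTop (𝓝 l) := by
  obtain ⟨D, hD, hl⟩ := h
  refine hl.congr fun n => ?_
  rw [← log_prod_expansionFactor hx]
  congr 2
  rcases hx.2.lt_or_eq with hlt | rfl
  · obtain ⟨A, hA, hA'⟩ := exists_hasDerivWithinAt hx n fun i _ =>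
      not_isPartitionPoint_of_hasDerivWithinAt ⟨hx.1, hlt⟩ hD i
    rw [(uniqueDiffWithinAt_unit hx).eq_deriv _ (hD n) hA', hA]
  -- The orbit stays at the partition point `1`, yet the exponent can exist there; all digits are
  -- then `2` and the two products agree.
  · rw [hasDerivWithinAt_one hD, abs_of_pos (by positivity)]
    simp [expansion_one, expansionFactor]
    norm_num

/-! ### Realising prescribed digits and the two spectra -/

/-- The value of the generalised Lueroth series. -/
noncomputable def seriesValue (a : ℕ → Fin 2 × ℕ) : ℝ := ∑' n, seriesTerm a n

lemma seriesValue_eq {a : ℕ → Fin 2 × ℕ} (h : ∀ n, 2 ≤ (a n).2) :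
    seriesValue a = branchOffset (a 0) + branchSlope (a 0) * seriesValue (fun i => a (i + 1)) := by
  rw [seriesValue, (summable_seriesTerm h).tsum_eq_zero_add, seriesValue, ← tsum_mul_left]
  congr 1
  · simp [seriesTerm_eq]
  · congr 1
    ext n
    rw [seriesTerm_eq, seriesTerm_eq, Finset.prod_range_succ']
    ring

lemma abs_seriesValue_le {a : ℕ → Fin 2 × ℕ} (h : ∀ n, 2 ≤ (a n).2) : |seriesValue a| ≤ 2 := by
  rw [← Real.norm_eq_abs]
  refine tsum_of_norm_bounded hasSum_geometric_two fun n => ?_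
  rw [seriesTerm_eq, norm_mul]
  have h1 := branchOffset_mem (h n)
  rw [Real.norm_eq_abs, Real.norm_eq_abs, abs_of_nonneg h1.1]
  calc _ ≤ (1 / 2 : ℝ) ^ n * 1 :=
        mul_le_mul (abs_prod_branchSlope_le h n) h1.2 h1.1 (by positivity)
    _ = _ := mul_one _

/-- The alternating Lueroth series with prescribed digits has all its tails in `[0,1]`. -/
lemma seriesValue_alternating_mem {d : ℕ → ℕ} (h : ∀ n, 2 ≤ d n) :
    seriesValue (fun n => (1, d n)) ∈ Icc (0 : ℝ) 1 := by
  -- An inverse branch maps `[0,1]` into itself and contracts by at least `2`, so each step halves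
  -- the possible excess over `[0,1]`, starting from the crude bound `2`. The induction runs over
  -- all digit sequences because it passes to the tail.
  have key : ∀ (m : ℕ) (d : ℕ → ℕ), (∀ n, 2 ≤ d n) →
      -(2 * (1 / 2 : ℝ) ^ m) ≤ seriesValue (fun n => (1, d n)) ∧
        seriesValue (fun n => (1, d n)) ≤ 1 + 2 * (1 / 2 : ℝ) ^ m := by
    intro m
    induction m with
    | zero =>
      intro d h
      have := abs_le.1 (abs_seriesValue_le (a := fun n => (1, d n)) h)
      constructor <;> linarith
    | succ m ih =>
      intro d h
      obtain ⟨h1, h2⟩ := ih (fun n => d (n + 1)) fun n => h _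
      rw [seriesValue_eq (a := fun n => (1, d n)) h]
      set y := seriesValue (fun n => (1, d (n + 1)))
      set ε : ℝ := (1 / 2 : ℝ) ^ m
      have hε : 0 < ε := by positivity
      have h3 := two_le_cast (h 0)
      have h4 : 0 < expansionFactor (1, d 0) := expansionFactor_pos (h 0)
      have h5 : 2 ≤ expansionFactor (1, d 0) := two_le_expansionFactor (h 0)
      have h6 : (d 0 : ℝ) ≤ expansionFactor (1, d 0) := by rw [expansionFactor]; nlinarith
      rw [pow_succ, branchOffset, branchSlope, div_mul_eq_mul_div, ← add_div]
      constructor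
      · rw [le_div_iff₀ h4]
        simp only [Fin.val_one, Nat.cast_one, pow_one]
        nlinarith
      · rw [div_le_iff₀ h4]
        simp only [Fin.val_one, Nat.cast_one, pow_one]
        nlinarith
  have hlim : Tendsto (fun m : ℕ => 2 * (1 / 2 : ℝ) ^ m) atTop (𝓝 0) := by
    have := (tendsto_pow_atTop_nhds_zero_of_lt_one (r := (1 / 2 : ℝ)) (by norm_num)
      (by norm_num)).const_mul 2
    rwa [mul_zero] at this
  constructor
  · have := hlim.neg
    rw [neg_zero] at this
    exact le_of_tendsto' this fun m => (key m d h).1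
  · have := hlim.const_add 1
    rw [add_zero] at this
    exact ge_of_tendsto' this fun m => (key m d h).2

/-- With `y` the value of the tail, the value is `(d 0 - y) / (d 0 * (d 0 - 1))`, and it lies in the
open cell exactly when `0 < y < 1`. Strictness is bootstrapped: `y ≤ 1` gives positivity, positivity
of the tail gives the strict upper bound. Sign `1` avoids exceptional sequences: constant digit `2`
gives `2/3`, whereas with sign `0` it gives the partition point `1`. -/
lemma seriesValue_alternating_inCell {d : ℕ → ℕ} (h : ∀ n, 2 ≤ d n) :
    InCell (d 0) (seriesValue (fun n => (1, d n))) ∧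
      mapT 1 (seriesValue (fun n => (1, d n))) = seriesValue (fun n => (1, d (n + 1))) := by
  have hrec : ∀ d : ℕ → ℕ, (∀ n, 2 ≤ d n) →
      d 0 * ((d 0 : ℝ) - 1) * seriesValue (fun n => (1, d n)) =
        d 0 - seriesValue (fun n => (1, d (n + 1))) := by
    intro d h
    rw [seriesValue_eq (a := fun n => (1, d n)) h]
    have h3 := two_le_cast (h 0)
    have h4 : (d 0 : ℝ) ≠ 0 := by linarith
    have h5 : (d 0 : ℝ) - 1 ≠ 0 := by linarith
    simp [branchOffset, branchSlope, expansionFactor]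
    field_simp
    ring
  have hpos : ∀ d : ℕ → ℕ, (∀ n, 2 ≤ d n) → 0 < seriesValue (fun n => (1, d n)) := by
    intro d h
    have h1 := hrec d h
    have h2 := (seriesValue_alternating_mem (d := fun n => d (n + 1)) fun n => h _).2
    have h3 := two_le_cast (h 0)
    by_contra hneg
    push Not at hneg
    have := mul_nonpos_of_nonneg_of_nonpos (show 0 ≤ (d 0 : ℝ) * ((d 0 : ℝ) - 1) by nlinarith) hneg
    linarith
  have hlt : ∀ d : ℕ → ℕ, (∀ n, 2 ≤ d n) →
      ((d 0 : ℝ) - 1) * seriesValue (fun n => (1, d n)) < 1 := by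
    intro d h
    have h1 := hrec d h
    have h2 := hpos (fun n => d (n + 1)) fun n => h _
    have h3 := two_le_cast (h 0)
    nlinarith
  have h1 := hrec d h
  have h3 := two_le_cast (h 0)
  have hcell : InCell (d 0) (seriesValue (fun n => (1, d n))) := by
    refine ⟨h 0, ?_, hlt d h⟩
    have h4 := hlt (fun n => d (n + 1)) fun n => h _
    have h5 := hpos (fun n => d (n + 1)) fun n => h _
    have h6 := two_le_cast (h 1)
    have h7 : seriesValue (fun n => (1, d (n + 1))) < 1 := by
      simp only [zero_add] at h4
      nlinarith
    nlinarith
  exact ⟨hcell, by rw [hcell.mapT_one]; linarith⟩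

/-- Every sequence of digits is realised by the alternating Lueroth map at a point whose orbit
avoids the points `1 / n`. -/
lemma exists_alternating_expansion {d : ℕ → ℕ} (h : ∀ n, 2 ≤ d n) :
    ∃ x ∈ Ioc (0 : ℝ) 1, (∀ n, ¬ IsPartitionPoint (orbit (fun _ => 1) n x)) ∧
      ∀ n, expansion (fun _ => 1) x n = (1, d n) := by
  have horb : ∀ n, orbit (fun _ => 1) n (seriesValue fun n => (1, d n)) =
      seriesValue (fun i => (1, d (i + n))) := by
    intro n
    induction n with
    | zero => rfl
    | succ n ih =>
      rw [orbit_succ, ih,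
        (seriesValue_alternating_inCell (d := fun i => d (i + n)) fun _ => h _).2]
      congr 1
      ext i
      · rfl
      · simp only; congr 1; ring
  have hcell : ∀ n, InCell (d n) (orbit (fun _ => 1) n (seriesValue fun n => (1, d n))) := by
    intro n
    rw [horb]
    simpa using (seriesValue_alternating_inCell (d := fun i => d (i + n)) fun _ => h _).1
  refine ⟨seriesValue fun n => (1, d n), ⟨(hcell 0).pos, (hcell 0).lt_one.le⟩,
    fun n => (hcell n).not_isPartitionPoint, fun n => ?_⟩
  rw [expansion_eq, iterate_randomMap, firstPair, (hcell n).firstSign, (hcell n).firstDigit]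

lemma floor_succ_mul {α : ℝ} (h0 : 0 ≤ α) (h1 : α ≤ 1) (n : ℕ) :
    ⌊α * ((n + 1 : ℕ) : ℝ)⌋₊ = ⌊α * (n : ℝ)⌋₊ ∨
      ⌊α * ((n + 1 : ℕ) : ℝ)⌋₊ = ⌊α * (n : ℝ)⌋₊ + 1 := by
  have hle : ⌊α * (n : ℝ)⌋₊ ≤ ⌊α * ((n + 1 : ℕ) : ℝ)⌋₊ := by
    apply Nat.floor_le_floor; push_cast; nlinarith
  have hge : ⌊α * ((n + 1 : ℕ) : ℝ)⌋₊ ≤ ⌊α * (n : ℝ)⌋₊ + 1 := by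
    rw [← Nat.floor_add_one (by positivity)]
    apply Nat.floor_le_floor; push_cast; linarith
  omega

/-- Every value `l ≥ log 2` is the limit of the averages for some sequence of digits. -/
lemma exists_digits {l : ℝ} (hl : Real.log 2 ≤ l) :
    ∃ d : ℕ → ℕ, (∀ n, 2 ≤ d n) ∧
      Tendsto (fun n : ℕ => 1 / (n : ℝ) *
        ∑ i ∈ Finset.range n, Real.log (expansionFactor (1, d i))) atTop (𝓝 l) := by
  obtain ⟨D, hD3, hD⟩ : ∃ D : ℕ, 3 ≤ D ∧ Real.exp l ≤ D := by
    refine ⟨⌈Real.exp l⌉₊ + 3, by omega, (Nat.le_ceil _).trans ?_⟩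
    push_cast; linarith
  have hD3' : (3 : ℝ) ≤ D := by exact_mod_cast hD3
  set L := Real.log (expansionFactor (1, D)) with hL
  have hf : (D : ℝ) ≤ expansionFactor (1, D) := by rw [expansionFactor]; nlinarith
  have hlL : l ≤ L := by
    rw [hL, Real.le_log_iff_exp_le (by linarith)]; exact hD.trans hf
  have h2L : Real.log 2 < L := Real.log_lt_log two_pos (by linarith)
  -- The frequency of the digit `D` for which the mean of `log 2` and `L` equals `l`.
  set α := (l - Real.log 2) / (L - Real.log 2) with hα
  have hα0 : 0 ≤ α := div_nonneg (by linarith) (by linarith)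
  have hα1 : α ≤ 1 := by rw [hα, div_le_one (by linarith)]; linarith
  have hαl : Real.log 2 + α * (L - Real.log 2) = l := by
    rw [hα, div_mul_cancel₀ _ (by linarith)]; ring
  -- The digit is `D` exactly where `⌊α n⌋` jumps, so the first `n` digits contain `⌊α n⌋` copies of
  -- `D`.
  refine ⟨fun n => if ⌊α * ((n + 1 : ℕ) : ℝ)⌋₊ = ⌊α * (n : ℝ)⌋₊ then 2 else D, fun n => ?_, ?_⟩
  · dsimp only; split_ifs <;> omega
  · have hsum : ∀ n : ℕ, ∑ i ∈ Finset.range n, Real.log (expansionFactor (1,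
        if ⌊α * ((i + 1 : ℕ) : ℝ)⌋₊ = ⌊α * (i : ℝ)⌋₊ then 2 else D)) =
        n * Real.log 2 + ⌊α * (n : ℝ)⌋₊ * (L - Real.log 2) := by
      intro n
      induction n with
      | zero => simp
      | succ n ih =>
        rw [Finset.sum_range_succ, ih]
        have h2 : expansionFactor ((1 : Fin 2), 2) = 2 := by norm_num [expansionFactor]
        split_ifs with hfl
        · rw [hfl, h2]; push_cast; ring
        · rw [(floor_succ_mul hα0 hα1 n).resolve_left hfl, ← hL]; push_cast; ring
    simp_rw [hsum]
    have h1 := (tendsto_nat_floor_mul_div_atTop hα0).comp (tendsto_natCast_atTop_atTop (R := ℝ))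
    have h2 := (h1.mul_const (L - Real.log 2)).const_add (Real.log 2)
    rw [hαl] at h2
    refine h2.congr' ?_
    filter_upwards [eventually_ge_atTop 1] with n hn
    have : (n : ℝ) ≠ 0 := by positivity
    simp only [Function.comp]
    field_simp

lemma exists_hasLyapunovExponent {l : ℝ} (hl : Real.log 2 ≤ l) :
    ∃ (ω : ℕ → Fin 2) (x : ℝ), x ∈ Ioc (0 : ℝ) 1 ∧ HasLyapunovExponent ω x l := by
  obtain ⟨d, hd, hlim⟩ := exists_digits hl
  obtain ⟨x, hx, hpart, hexp⟩ := exists_alternating_expansion hd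
  refine ⟨_, x, hx, hasLyapunovExponent_of_tendsto hx hpart (hlim.congr fun n => ?_)⟩
  simp only [logFactorSum, hexp]

lemma setOf_hasLyapunovExponent :
    {l : ℝ | ∃ (ω : ℕ → Fin 2) (x : ℝ), x ∈ Ioc (0 : ℝ) 1 ∧ HasLyapunovExponent ω x l} =
      Ici (Real.log 2) := by
  ext l
  constructor
  · rintro ⟨ω, x, hx, h⟩
    exact le_of_tendsto_logFactorSum hx (tendsto_of_hasLyapunovExponent hx h)
  · exact exists_hasLyapunovExponent

lemma setOf_hasRate :
    {r : ℝ | ∃ (ω : ℕ → Fin 2) (x : ℝ), x ∈ Ioc (0 : ℝ) 1 ∧ HasRate ω x r} =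
      Iic (-Real.log 2) := by
  ext r
  constructor
  · rintro ⟨ω, x, hx, h⟩
    exact rate_le hx h
  · intro hr
    obtain ⟨ω, x, hx, h⟩ := exists_hasLyapunovExponent (l := -r) (by
      have : r ≤ -Real.log 2 := hr
      linarith)
    refine ⟨ω, x, hx, ?_⟩
    simpa using hasRate_of_tendsto hx (tendsto_of_hasLyapunovExponent hx h)

/-! ### Invariance of the product measure and independence of the digits -/

open ProbabilityTheory

/-- The one-letter distribution of the Bernoulli measure. -/
noncomputable abbrev letterMeasure (p : unitInterval) : Measure (Fin 2) :=
  bernoulliMeasure (0 : Fin 2) 1 p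

/-- Lebesgue measure on the unit interval. -/
noncomputable abbrev unitVolume : Measure ℝ := volume.restrict (Icc (0 : ℝ) 1)

instance : IsProbabilityMeasure unitVolume := ⟨by simp⟩

instance (p : unitInterval) : IsProbabilityMeasure (bernoulliSeq p) := by
  unfold bernoulliSeq; infer_instance

instance (p : unitInterval) : IsProbabilityMeasure (productMeasure p) := by
  unfold productMeasure; infer_instance

/-- The left shift on sequences of letters. -/
def shift (ω : ℕ → Fin 2) : ℕ → Fin 2 := fun i => ω (i + 1)

lemma measurable_shift : Measurable shift :=
  measurable_pi_iff.2 fun i => measurable_pi_apply (i + 1)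

lemma countable_isPartitionPoint : {x : ℝ | IsPartitionPoint x}.Countable := by
  refine (countable_range fun n : ℕ => 1 / (n : ℝ)).mono ?_
  rintro x ⟨n, -, rfl⟩
  exact ⟨n, rfl⟩

lemma measurableSet_isPartitionPoint : MeasurableSet {x : ℝ | IsPartitionPoint x} :=
  countable_isPartitionPoint.measurableSet

lemma measurable_mapL : Measurable mapL := by
  have h : Measurable fun x : ℝ => (⌈1 / x⌉ : ℝ) :=
    (measurable_from_top (f := fun n : ℤ => (n : ℝ))).comp
      (Int.measurable_ceil.comp (measurable_const.div measurable_id))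
  refine Measurable.ite (measurableSet_singleton (0 : ℝ)) measurable_const ?_
  refine Measurable.ite (measurableSet_singleton (1 : ℝ)) measurable_const ?_
  exact ((h.mul (h.sub_const 1)).mul measurable_id).sub (h.sub_const 1)

lemma measurable_mapT (j : Fin 2) : Measurable (mapT j) := by
  refine Measurable.ite ?_ measurable_const ?_
  · exact (measurableSet_singleton (0 : ℝ)).union measurableSet_isPartitionPoint
  · exact Measurable.ite (.const _) measurable_mapL (measurable_mapL.const_sub 1)

lemma measurable_randomMap : Measurable randomMap := by
  refine (measurable_shift.comp measurable_fst).prodMk ?_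
  have : (fun z : (ℕ → Fin 2) × ℝ => mapT (z.1 0) z.2) =
      fun z => if z.1 0 = 0 then mapT 0 z.2 else mapT 1 z.2 := by
    ext z
    rcases Fin.exists_fin_two.1 ⟨z.1 0, rfl⟩ with h | h <;> simp [h]
  rw [this]
  refine Measurable.ite ?_ ((measurable_mapT 0).comp measurable_snd)
    ((measurable_mapT 1).comp measurable_snd)
  exact measurableSet_eq_fun ((measurable_pi_apply (X := fun _ : ℕ => Fin 2) 0).comp measurable_fst)
    measurable_const

lemma measurable_firstDigit : Measurable firstDigit :=
  Measurable.ite (measurableSet_singleton (1 : ℝ)) measurable_const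
    (Nat.measurable_ceil.comp (measurable_const.div measurable_id))

lemma measurable_firstSign : Measurable firstSign := by
  refine Measurable.ite (measurable_snd (measurableSet_singleton (1 : ℝ))) measurable_const ?_
  exact Measurable.ite (measurable_snd measurableSet_isPartitionPoint) measurable_const
    ((measurable_pi_apply 0).comp measurable_fst)

lemma measurable_firstPair : Measurable firstPair :=
  measurable_firstSign.prodMk (measurable_firstDigit.comp measurable_snd)

/-- The Bernoulli measure is the product of its first marginal and itself. -/
lemma map_cons_bernoulliSeq (p : unitInterval) :
    ((letterMeasure p).prod (bernoulliSeq p)).map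
      (fun q i => Nat.casesOn i q.1 q.2 : Fin 2 × (ℕ → Fin 2) → ℕ → Fin 2) = bernoulliSeq p := by
  classical
  refine Measure.eq_infinitePi _ fun s t ht => ?_
  have hmeas : Measurable (fun q i => Nat.casesOn i q.1 q.2 :
      Fin 2 × (ℕ → Fin 2) → ℕ → Fin 2) := by
    refine measurable_pi_iff.2 fun i => ?_
    cases i with
    | zero => exact measurable_fst
    | succ i => exact (measurable_pi_apply i).comp measurable_snd
  rw [Measure.map_apply hmeas (MeasurableSet.pi s.countable_toSet fun i _ => ht i)]
  obtain ⟨n, hn⟩ : ∃ n, s ⊆ Finset.range (n + 1) := by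
    refine ⟨s.sup id, fun i hi => Finset.mem_range.2 ?_⟩
    have := Finset.le_sup (f := id) hi
    simp only [id] at this
    omega
  -- Unconstrained coordinates are padded with `univ`, so that the cylinder constrains an initial
  -- segment and coordinate `0` splits off.
  set t' : ℕ → Set (Fin 2) := fun i => if i ∈ s then t i else univ with ht'
  have hpre : (fun q i => Nat.casesOn i q.1 q.2 : Fin 2 × (ℕ → Fin 2) → ℕ → Fin 2) ⁻¹'
      (Set.pi s t) = t' 0 ×ˢ Set.pi (Finset.range n) (fun i => t' (i + 1)) := by
    ext ⟨b, η⟩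
    simp only [mem_preimage, Set.mem_pi, mem_prod]
    constructor
    · intro h
      refine ⟨?_, fun i _ => ?_⟩
      · by_cases h0 : 0 ∈ s
        · simpa [ht', h0] using h 0 h0
        · simp [ht', h0]
      · by_cases h0 : i + 1 ∈ s
        · simpa [ht', h0] using h (i + 1) h0
        · simp [ht', h0]
    · rintro ⟨h0, h1⟩ i hi
      have hi' : i ∈ s := hi
      cases i with
      | zero =>
        simp only [ht', if_pos hi'] at h0
        exact h0
      | succ i =>
        have := h1 i (by have := Finset.mem_range.1 (hn hi); simpa using this)
        simpa only [ht', if_pos hi'] using this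
  rw [hpre, Measure.prod_prod, bernoulliSeq, Measure.infinitePi_pi]
  · have h1 : ∏ i ∈ s, (letterMeasure p) (t i) =
        ∏ i ∈ Finset.range (n + 1), (letterMeasure p) (t' i) := by
      rw [← Finset.prod_subset hn]
      · exact Finset.prod_congr rfl fun i hi => by simp [ht', hi]
      · intro i _ hi
        simp [ht', hi]
    rw [h1, Finset.prod_range_succ', mul_comm]
  · intro i _
    simp only [ht']
    split_ifs
    · exact ht _
    · exact .univ

lemma map_shift_restrict (p : unitInterval) (s : Fin 2) :
    ((bernoulliSeq p).restrict {ω | ω 0 = s}).map shift =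
      (letterMeasure p) {s} • bernoulliSeq p := by
  have hs : MeasurableSet {ω : ℕ → Fin 2 | ω 0 = s} :=
    measurableSet_eq_fun (measurable_pi_apply (X := fun _ : ℕ => Fin 2) 0) measurable_const
  have hmeas : Measurable (fun q i => Nat.casesOn i q.1 q.2 :
      Fin 2 × (ℕ → Fin 2) → ℕ → Fin 2) := by
    refine measurable_pi_iff.2 fun i => ?_
    cases i with
    | zero => exact measurable_fst
    | succ i => exact (measurable_pi_apply i).comp measurable_snd
  ext A hA
  rw [Measure.map_apply measurable_shift hA, Measure.restrict_apply (measurable_shift hA)]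
  conv_lhs => rw [← map_cons_bernoulliSeq p]
  rw [Measure.map_apply hmeas ((measurable_shift hA).inter hs), Measure.smul_apply, smul_eq_mul,
    ← Measure.prod_prod]
  congr 1
  ext ⟨b, η⟩
  simp only [mem_preimage, mem_inter_iff, mem_ofPred_eq, mem_prod, mem_singleton_iff]
  rw [and_comm]
  rfl

lemma measurableSet_inCell (n : ℕ) : MeasurableSet {x | InCell n x} := by
  refine (MeasurableSet.const _).inter ?_
  exact (measurableSet_lt measurable_const (measurable_id.const_mul _)).inter
    (measurableSet_lt (measurable_id.const_mul _) measurable_const)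

lemma volume_preimage_affine {A : ℝ} (hA : A ≠ 0) (B : ℝ) (S : Set ℝ) :
    volume ((fun x => A * x + B) ⁻¹' S) = ENNReal.ofReal (1 / |A|) * volume S := by
  have : (fun x => A * x + B) ⁻¹' S = (A * ·) ⁻¹' ((· + B) ⁻¹' S) := rfl
  rw [this, Real.volume_preimage_mul_left hA, measure_preimage_add_right, abs_inv, one_div]

lemma map_mapT_restrict (s : Fin 2) (n : ℕ) :
    (unitVolume.restrict {x | InCell n x}).map (mapT s) =
      ENNReal.ofReal (1 / expansionFactor (s, n)) • unitVolume := by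
  -- For `n < 2` the cell is empty and the factor is `0`, so both sides vanish because `1 / 0 = 0`.
  rcases Nat.lt_or_ge n 2 with hn | hn
  · have h1 : {x | InCell n x} = ∅ := by
      ext x
      simp only [mem_ofPred_eq, mem_empty_iff_false, iff_false]
      exact fun h => absurd h.1 (by omega)
    have h2 : expansionFactor (s, n) = 0 := by
      rw [expansionFactor]
      interval_cases n <;> norm_num
    rw [h1, h2]
    simp
  · have hn2 := two_le_cast hn
    ext B hB
    rw [Measure.map_apply (measurable_mapT s) hB, Measure.restrict_apply (measurable_mapT s hB),
      Measure.smul_apply, smul_eq_mul,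
      unitVolume, ← Measure.restrict_congr_set (Ioo_ae_eq_Icc (a := (0 : ℝ)) (b := 1)),
      Measure.restrict_apply hB, Measure.restrict_congr_set (Ioo_ae_eq_Icc (a := (0 : ℝ)) (b := 1)),
      Measure.restrict_apply ((measurable_mapT s hB).inter (measurableSet_inCell n))]
    obtain ⟨A, C, hA, hT, hiff⟩ : ∃ A C : ℝ, |A| = expansionFactor (s, n) ∧
        (∀ x, InCell n x → mapT s x = A * x + C) ∧
        (∀ x, InCell n x ↔ A * x + C ∈ Ioo (0 : ℝ) 1) := by
      have hpos : (0 : ℝ) < n * ((n : ℝ) - 1) := by nlinarith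
      rcases Fin.exists_fin_two.1 ⟨s, rfl⟩ with rfl | rfl
      · refine ⟨n * ((n : ℝ) - 1), -((n : ℝ) - 1), abs_of_pos hpos,
          fun x hx => by rw [hx.mapT_zero]; ring, fun x => ⟨fun hx => ?_, fun hx => ?_⟩⟩
        · have := hx.mapT_mem 0
          rwa [hx.mapT_zero, sub_eq_add_neg] at this
        · obtain ⟨h1, h2⟩ := hx
          refine ⟨hn, ?_, ?_⟩ <;> nlinarith
      · refine ⟨-(n * ((n : ℝ) - 1)), n, by rw [abs_neg, abs_of_pos hpos]; rfl,
          fun x hx => by rw [hx.mapT_one]; ring, fun x => ⟨fun hx => ?_, fun hx => ?_⟩⟩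
        · have := hx.mapT_mem 1
          rw [hx.mapT_one] at this
          convert this using 1
          ring
        · obtain ⟨h1, h2⟩ := hx
          refine ⟨hn, ?_, ?_⟩ <;> nlinarith
    have hset : mapT s ⁻¹' B ∩ {x | InCell n x} ∩ Icc 0 1 =
        (fun x => A * x + C) ⁻¹' (B ∩ Ioo 0 1) := by
      ext x
      simp only [mem_inter_iff, mem_preimage, mem_ofPred_eq]
      constructor
      · rintro ⟨⟨h1, h2⟩, -⟩
        rw [hT x h2] at h1
        exact ⟨h1, (hiff x).1 h2⟩
      · rintro ⟨h1, h2⟩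
        have h3 := (hiff x).2 h2
        exact ⟨⟨by rwa [hT x h3], h3⟩, h3.pos.le, h3.lt_one.le⟩
    have hA0 : A ≠ 0 := by
      rw [← abs_pos, hA]; exact expansionFactor_pos hn
    rw [hset, volume_preimage_affine hA0, hA]

/-- The generic points: irrational numbers in `(0,1)`. -/
def genericPoints : Set ℝ := {x | Irrational x} ∩ Ioo 0 1

lemma ae_mem_genericPoints : ∀ᵐ x ∂unitVolume, x ∈ genericPoints := by
  have h1 : ∀ᵐ x ∂(volume : Measure ℝ), x ∉ range ((↑) : ℚ → ℝ) :=
    (countable_range _).ae_notMem _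
  have h2 : ∀ᵐ x ∂unitVolume, x ∈ Ioo (0 : ℝ) 1 := by
    rw [unitVolume, ← Measure.restrict_congr_set (Ioo_ae_eq_Icc (a := (0 : ℝ)) (b := 1))]
    exact ae_restrict_mem measurableSet_Ioo
  filter_upwards [ae_restrict_of_ae h1, h2] with x h1 h2 using ⟨h1, h2⟩

lemma not_isPartitionPoint_of_generic {x : ℝ} (hx : x ∈ genericPoints) : ¬ IsPartitionPoint x := by
  rintro ⟨n, -, rfl⟩
  exact hx.1 ⟨1 / n, by simp⟩

lemma genericPoints_subset : genericPoints ⊆ Ioc 0 1 := fun _ hx => Ioo_subset_Ioc_self hx.2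

/-- Branches have integer coefficients and nonzero slope, so irrationality persists and the
conventions at `1/n` never matter along a generic orbit. -/
lemma mapT_mem_genericPoints {x : ℝ} (hx : x ∈ genericPoints) (j : Fin 2) :
    mapT j x ∈ genericPoints := by
  obtain ⟨n, hn⟩ := exists_inCell (genericPoints_subset hx) (not_isPartitionPoint_of_generic hx)
  refine ⟨?_, hn.mapT_mem j⟩
  have h2 : n * (n - 1) ≠ 0 := mul_ne_zero (by have := hn.1; omega) (by have := hn.1; omega)
  have h1 : (1 : ℕ) ≤ n := by have := hn.1; omega
  have hcast : ((n * (n - 1) : ℕ) : ℝ) = n * ((n : ℝ) - 1) := by push_cast [h1]; ring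
  have h3 : Irrational ((n * (n - 1) : ℕ) * x) := hx.1.natCast_mul h2
  rw [hcast] at h3
  rcases Fin.exists_fin_two.1 ⟨j, rfl⟩ with rfl | rfl
  · rw [hn.mapT_zero]
    have := h3.sub_natCast (n - 1)
    rwa [Nat.cast_sub h1, Nat.cast_one] at this
  · rw [hn.mapT_one]
    exact h3.natCast_sub n

lemma orbit_mem_genericPoints {x : ℝ} (hx : x ∈ genericPoints) (ω : ℕ → Fin 2) (n : ℕ) :
    orbit ω n x ∈ genericPoints := by
  induction n with
  | zero => exact hx
  | succ n ih => rw [orbit_succ]; exact mapT_mem_genericPoints ih _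

lemma ae_snd_mem_genericPoints (p : unitInterval) :
    ∀ᵐ z ∂productMeasure p, z.2 ∈ genericPoints :=
  Measure.quasiMeasurePreserving_snd.ae ae_mem_genericPoints

lemma firstPair_eq_iff {ω : ℕ → Fin 2} {x : ℝ} (hx : x ∈ genericPoints) (c : Fin 2 × ℕ) :
    firstPair (ω, x) = c ↔ ω 0 = c.1 ∧ InCell c.2 x := by
  obtain ⟨n, hn⟩ := exists_inCell (genericPoints_subset hx) (not_isPartitionPoint_of_generic hx)
  rw [firstPair, hn.firstSign, hn.firstDigit, Prod.ext_iff]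
  refine and_congr_right fun _ => ⟨fun h => by rw [← h]; exact hn, fun h => ?_⟩
  have h1 := h.firstDigit
  rw [hn.firstDigit] at h1
  exact h1

/-- The probability of a pair of a sign and a digit. -/
noncomputable def pairWeight (p : unitInterval) (c : Fin 2 × ℕ) : ENNReal :=
  (letterMeasure p) {c.1} * ENNReal.ofReal (1 / expansionFactor c)

/-- On the cylinder of `c` the random map is the product of the shift and one affine branch onto
`(0,1)`. Both push the restricted measure to a multiple of the full one, so the cylinder carries no
information about the image. Invariance and independence are both read off from this formula. -/
lemma measure_firstPair_inter_preimage_singleton (p : unitInterval) (c : Fin 2 × ℕ)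
    {S : Set ((ℕ → Fin 2) × ℝ)} (hS : MeasurableSet S) :
    productMeasure p (firstPair ⁻¹' {c} ∩ randomMap ⁻¹' S) =
      pairWeight p c * productMeasure p S := by
  set g : (ℕ → Fin 2) × ℝ → (ℕ → Fin 2) × ℝ := Prod.map shift (mapT c.1) with hg
  set C : Set ((ℕ → Fin 2) × ℝ) := {ω | ω 0 = c.1} ×ˢ {x | InCell c.2 x} with hC
  have hgm : Measurable g := measurable_shift.prodMap (measurable_mapT _)
  have h1 : ((productMeasure p).restrict C).map g = pairWeight p c • productMeasure p := by
    rw [hC, productMeasure, ← Measure.prod_restrict, hg,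
      ← Measure.map_prod_map _ _ measurable_shift (measurable_mapT _), map_shift_restrict,
      map_mapT_restrict, Measure.prod_smul_left, Measure.prod_smul_right, smul_smul]
    rfl
  have h2 : productMeasure p (g ⁻¹' S ∩ C) = pairWeight p c * productMeasure p S := by
    rw [← smul_eq_mul, ← Measure.smul_apply, ← h1, Measure.map_apply hgm hS,
      Measure.restrict_apply (hgm hS)]
  rw [← h2]
  apply measure_congr
  filter_upwards [ae_snd_mem_genericPoints p] with z hz
  obtain ⟨ω, x⟩ := z
  apply propext
  change firstPair (ω, x) = c ∧ randomMap (ω, x) ∈ S ↔ g (ω, x) ∈ S ∧ (ω 0 = c.1 ∧ InCell c.2 x)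
  rw [firstPair_eq_iff hz, and_comm]
  refine and_congr_left fun h => ?_
  have : g (ω, x) = randomMap (ω, x) := by
    simp only [hg, Prod.map, randomMap, h.1]
    rfl
  rw [this]

lemma measure_firstPair_preimage_singleton (p : unitInterval) (c : Fin 2 × ℕ) :
    productMeasure p (firstPair ⁻¹' {c}) = pairWeight p c := by
  have := measure_firstPair_inter_preimage_singleton p c MeasurableSet.univ
  simpa using this

lemma measure_firstPair_inter_preimage (p : unitInterval) (U : Set (Fin 2 × ℕ))
    {S : Set ((ℕ → Fin 2) × ℝ)} (hS : MeasurableSet S) :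
    productMeasure p (firstPair ⁻¹' U ∩ randomMap ⁻¹' S) =
      productMeasure p (firstPair ⁻¹' U) * productMeasure p S := by
  have hd : ∀ V : Set ((ℕ → Fin 2) × ℝ),
      U.PairwiseDisjoint fun c => firstPair ⁻¹' {c} ∩ V := fun V c _ c' _ hcc' =>
    Disjoint.mono inter_subset_left inter_subset_left
      ((disjoint_singleton.2 hcc').preimage firstPair)
  have hm : ∀ c, MeasurableSet (firstPair ⁻¹' {c}) := fun c =>
    measurable_firstPair (measurableSet_singleton c)
  have key : ∀ V : Set ((ℕ → Fin 2) × ℝ), MeasurableSet V →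
      productMeasure p (firstPair ⁻¹' U ∩ V) =
        ∑' c : U, productMeasure p (firstPair ⁻¹' {(c : Fin 2 × ℕ)} ∩ V) := by
    intro V hV
    rw [← measure_biUnion U.to_countable (hd V) fun c _ => (hm c).inter hV, ← iUnion₂_inter,
      ← preimage_iUnion₂, biUnion_of_singleton]
  have h1 := key univ MeasurableSet.univ
  simp only [inter_univ] at h1
  rw [key _ (measurable_randomMap hS), h1, ← ENNReal.tsum_mul_right]
  refine tsum_congr fun c => ?_
  rw [measure_firstPair_inter_preimage_singleton p c hS, measure_firstPair_preimage_singleton]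

lemma measurePreserving_randomMap (p : unitInterval) :
    MeasurePreserving randomMap (productMeasure p) (productMeasure p) := by
  refine ⟨measurable_randomMap, ?_⟩
  ext S hS
  have := measure_firstPair_inter_preimage p univ hS
  rw [Measure.map_apply measurable_randomMap hS]
  simpa using this

/-- The first sign and digit are independent of the image point. -/
lemma indepFun_firstPair_randomMap (p : unitInterval) :
    IndepFun firstPair randomMap (productMeasure p) := by
  rw [indepFun_iff_measure_inter_preimage_eq_mul]
  intro U S _ hS
  rw [measure_firstPair_inter_preimage p U hS,
    (measurePreserving_randomMap p).measure_preimage hS.nullMeasurableSet]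

/-! ### A strong law for bounded orthogonal sequences -/

section StrongLaw

variable {Ω : Type*} [MeasurableSpace Ω] {μ : Measure Ω} [IsProbabilityMeasure μ]
  {Z : ℕ → Ω → ℝ} {C : ℝ}

lemma integrable_of_ae_abs_le {f : Ω → ℝ} (hm : Measurable f) (hC : ∀ᵐ ω ∂μ, |f ω| ≤ C) :
    Integrable f μ :=
  Integrable.of_bound hm.aestronglyMeasurable C hC

/-- Orthogonality removes the cross terms, so the second moment of the sum grows only linearly. -/
lemma integral_sq_sum_le_of_orthogonal (hm : ∀ i, Measurable (Z i))
    (hC : ∀ᵐ ω ∂μ, ∀ i, |Z i ω| ≤ C) (horth : ∀ i j, i < j → ∫ ω, Z i ω * Z j ω ∂μ = 0) (n : ℕ) :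
    ∫ ω, (∑ i ∈ Finset.range n, Z i ω) ^ 2 ∂μ ≤ n * C ^ 2 := by
  have hint : ∀ i j, Integrable (fun ω => Z i ω * Z j ω) μ := fun i j =>
    integrable_of_ae_abs_le (C := C * C) ((hm i).mul (hm j)) (by
      filter_upwards [hC] with ω h
      rw [abs_mul]
      exact mul_le_mul (h i) (h j) (abs_nonneg _) ((abs_nonneg _).trans (h i)))
  have hprod : ∀ n m, Integrable (fun ω => (∑ i ∈ Finset.range n, Z i ω) * Z m ω) μ := by
    intro n m
    simp_rw [Finset.sum_mul]
    exact integrable_finsetSum _ fun i _ => hint i m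
  have hsq : ∀ n, Integrable (fun ω => (∑ i ∈ Finset.range n, Z i ω) ^ 2) μ := by
    intro n
    simp_rw [sq, Finset.mul_sum]
    exact integrable_finsetSum _ fun i _ => hprod n i
  induction n with
  | zero => simp
  | succ n ih =>
    have h1 : ∀ ω, (∑ i ∈ Finset.range (n + 1), Z i ω) ^ 2 =
        (∑ i ∈ Finset.range n, Z i ω) ^ 2 +
          (2 * ((∑ i ∈ Finset.range n, Z i ω) * Z n ω) + Z n ω * Z n ω) := by
      intro ω
      rw [Finset.sum_range_succ]
      ring
    have h2 : ∫ ω, (∑ i ∈ Finset.range n, Z i ω) * Z n ω ∂μ = 0 := by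
      simp_rw [Finset.sum_mul]
      rw [integral_finsetSum _ fun i _ => hint i n]
      exact Finset.sum_eq_zero fun i hi => horth i n (Finset.mem_range.1 hi)
    have h3 : ∫ ω, Z n ω * Z n ω ∂μ ≤ C ^ 2 := by
      have : ∫ ω, Z n ω * Z n ω ∂μ ≤ ∫ _, C ^ 2 ∂μ := by
        refine integral_mono_ae (hint n n) (integrable_const _) ?_
        filter_upwards [hC] with ω h
        have := h n
        rw [← sq]
        exact sq_le_sq' (by linarith [neg_abs_le (Z n ω)]) (by linarith [le_abs_self (Z n ω)])
      simpa using this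
    simp_rw [h1]
    have hadd : Integrable (fun ω => 2 * ((∑ i ∈ Finset.range n, Z i ω) * Z n ω) +
      Z n ω * Z n ω) μ := ((hprod n n).const_mul 2).add (hint n n)
    rw [integral_add (hsq n) hadd, integral_add ((hprod n n).const_mul 2) (hint n n), integral_const_mul, h2]
    push_cast
    linarith

omit [IsProbabilityMeasure μ] in
lemma ae_tendsto_zero_of_summable_integral {f : ℕ → Ω → ℝ} (hm : ∀ n, Measurable (f n))
    (h0 : ∀ n ω, 0 ≤ f n ω) (hi : ∀ n, Integrable (f n) μ)
    (hs : Summable fun n => ∫ ω, f n ω ∂μ) : ∀ᵐ ω ∂μ, Tendsto (fun n => f n ω) atTop (𝓝 0) := by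
  have h1 : ∫⁻ ω, ∑' n, ENNReal.ofReal (f n ω) ∂μ ≠ ⊤ := by
    rw [lintegral_tsum fun n => (hm n).ennreal_ofReal.aemeasurable]
    simp_rw [← ofReal_integral_eq_lintegral_ofReal (hi _) (ae_of_all _ (h0 _))]
    exact hs.tsum_ofReal_ne_top
  have h2 := ae_lt_top' (Measurable.aemeasurable (Measurable.tsum fun n =>
    (hm n).ennreal_ofReal)) h1
  filter_upwards [h2] with ω hω
  have h3 := ENNReal.tendsto_atTop_zero_of_tsum_ne_top hω.ne
  have h4 := (ENNReal.tendsto_toReal ENNReal.zero_ne_top).comp h3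
  simpa [Function.comp_def, ENNReal.toReal_ofReal (h0 _ _)] using h4

/-- The averages of a bounded sequence converge if they do along the squares. -/
lemma tendsto_average_of_tendsto_squares {z : ℕ → ℝ} (hC : ∀ i, |z i| ≤ C)
    (h : Tendsto (fun n : ℕ => 1 / ((n ^ 2 : ℕ) : ℝ) * ∑ i ∈ Finset.range (n ^ 2), z i)
      atTop (𝓝 0)) :
    Tendsto (fun n : ℕ => 1 / (n : ℝ) * ∑ i ∈ Finset.range n, z i) atTop (𝓝 0) := by
  have hC0 : 0 ≤ C := (abs_nonneg _).trans (hC 0)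
  have hsqrt : Tendsto Nat.sqrt atTop atTop :=
    tendsto_atTop_atTop.2 fun b => ⟨b * b, fun a ha => Nat.le_sqrt.2 ha⟩
  have h1 : Tendsto (fun n : ℕ => |1 / ((n ^ 2 : ℕ) : ℝ) * ∑ i ∈ Finset.range (n ^ 2), z i| +
      2 * C * (1 / (n : ℝ))) atTop (𝓝 0) := by
    have := h.abs.add (tendsto_one_div_atTop_nhds_zero_nat.const_mul (2 * C))
    simpa using this
  refine squeeze_zero_norm' ?_ (h1.comp hsqrt)
  filter_upwards [eventually_ge_atTop 1] with m hm
  set n := m.sqrt with hn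
  have hn1 : 1 ≤ n := Nat.le_sqrt.2 (by simpa using hm)
  have hle : n ^ 2 ≤ m := by rw [sq]; exact Nat.sqrt_le m
  -- Between consecutive squares there are at most `2 * n` further terms, which cost `2 * C / n` in
  -- the average.
  have hge : m ≤ n ^ 2 + 2 * n := by
    have := Nat.sqrt_le_add m
    rw [← hn] at this
    nlinarith
  have hnR : (1 : ℝ) ≤ n := by exact_mod_cast hn1
  have hleR : (n : ℝ) ^ 2 ≤ m := by exact_mod_cast hle
  have hgeR : (m : ℝ) ≤ (n : ℝ) ^ 2 + 2 * n := by exact_mod_cast hge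
  have hsplit : ∑ i ∈ Finset.range m, z i =
      ∑ i ∈ Finset.range (n ^ 2), z i + ∑ i ∈ Finset.Ico (n ^ 2) m, z i :=
    (Finset.sum_range_add_sum_Ico _ hle).symm
  have htail : |∑ i ∈ Finset.Ico (n ^ 2) m, z i| ≤ 2 * n * C := by
    calc _ ≤ ∑ i ∈ Finset.Ico (n ^ 2) m, |z i| := Finset.abs_sum_le_sum_abs _ _
      _ ≤ ∑ i ∈ Finset.Ico (n ^ 2) m, C := Finset.sum_le_sum fun i _ => hC i
      _ = ((m : ℝ) - (n : ℝ) ^ 2) * C := by simp [Nat.cast_sub hle]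
      _ ≤ _ := mul_le_mul_of_nonneg_right (by linarith) hC0
  set A := ∑ i ∈ Finset.range (n ^ 2), z i
  have hn2 : (0 : ℝ) < (n : ℝ) ^ 2 := by positivity
  simp only [Function.comp, ← hn]
  rw [hsplit, norm_mul, Real.norm_eq_abs, Real.norm_eq_abs,
    abs_of_nonneg (show (0 : ℝ) ≤ 1 / (m : ℝ) by positivity), abs_mul,
    abs_of_nonneg (show (0 : ℝ) ≤ 1 / ((n ^ 2 : ℕ) : ℝ) by positivity)]
  calc 1 / (m : ℝ) * |A + ∑ i ∈ Finset.Ico (n ^ 2) m, z i|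
      ≤ 1 / (n : ℝ) ^ 2 * (|A| + 2 * n * C) :=
        mul_le_mul (one_div_le_one_div_of_le hn2 hleR)
          ((abs_add_le _ _).trans (by linarith)) (abs_nonneg _) (by positivity)
    _ = _ := by push_cast; field_simp; rfl

/-- A strong law of large numbers for bounded orthogonal sequences. -/
theorem ae_tendsto_average_of_orthogonal (hm : ∀ i, Measurable (Z i))
    (hC : ∀ᵐ ω ∂μ, ∀ i, |Z i ω| ≤ C) (horth : ∀ i j, i < j → ∫ ω, Z i ω * Z j ω ∂μ = 0) :
    ∀ᵐ ω ∂μ, Tendsto (fun n : ℕ => 1 / (n : ℝ) * ∑ i ∈ Finset.range n, Z i ω) atTop (𝓝 0) := by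
  set f : ℕ → Ω → ℝ := fun n ω =>
    (1 / ((n ^ 2 : ℕ) : ℝ) * ∑ i ∈ Finset.range (n ^ 2), Z i ω) ^ 2 with hf
  have hSm : ∀ n, Measurable fun ω => ∑ i ∈ Finset.range n, Z i ω := fun n =>
    Finset.measurable_fun_sum _ fun i _ => hm i
  have hfm : ∀ n, Measurable (f n) := fun n => ((hSm _).const_mul _).pow_const 2
  have hSb : ∀ n, ∀ᵐ ω ∂μ, |∑ i ∈ Finset.range n, Z i ω| ≤ n * C := by
    intro n
    filter_upwards [hC] with ω h
    calc _ ≤ ∑ i ∈ Finset.range n, |Z i ω| := Finset.abs_sum_le_sum_abs _ _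
      _ ≤ ∑ i ∈ Finset.range n, C := Finset.sum_le_sum fun i _ => h i
      _ = _ := by simp
  have hfi : ∀ n, Integrable (f n) μ := by
    intro n
    have : Integrable (fun ω => (∑ i ∈ Finset.range (n ^ 2), Z i ω) ^ 2) μ := by
      refine integrable_of_ae_abs_le (C := (((n ^ 2 : ℕ) : ℝ) * C) ^ 2) ((hSm _).pow_const 2) ?_
      filter_upwards [hSb (n ^ 2)] with ω h
      rw [abs_pow]
      exact pow_le_pow_left₀ (abs_nonneg _) h 2
    simp only [hf, mul_pow]
    exact this.const_mul _
  -- Along the squares the second moments of the averages are at most `C ^ 2 / n ^ 2`.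
  have hsum : Summable fun n => ∫ ω, f n ω ∂μ := by
    have hs : Summable fun n : ℕ => C ^ 2 * (1 / (n : ℝ) ^ 2) :=
      (Real.summable_one_div_nat_pow.2 one_lt_two).mul_left _
    refine hs.of_nonneg_of_le (fun n => integral_nonneg fun ω => sq_nonneg _) fun n => ?_
    have h1 := integral_sq_sum_le_of_orthogonal hm hC horth (n ^ 2)
    simp only [hf, mul_pow]
    rw [integral_const_mul]
    rcases Nat.eq_zero_or_pos n with rfl | hn
    · simp
    · have hn0 : (0 : ℝ) < n := by exact_mod_cast hn
      calc _ ≤ (1 / ((n ^ 2 : ℕ) : ℝ)) ^ 2 * (((n ^ 2 : ℕ) : ℝ) * C ^ 2) :=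
            mul_le_mul_of_nonneg_left h1 (by positivity)
        _ = _ := by push_cast; field_simp
  filter_upwards [ae_tendsto_zero_of_summable_integral hfm (fun n ω => sq_nonneg _) hfi hsum, hC]
    with ω h1 h2
  refine tendsto_average_of_tendsto_squares h2 ?_
  have h3 := h1.sqrt
  simp only [hf, Real.sqrt_sq_eq_abs, Real.sqrt_zero] at h3
  exact tendsto_zero_iff_abs_tendsto_zero _ |>.2 h3

end StrongLaw

/-! ### Averages along typical orbits -/

lemma measurable_pairs {β : Type*} [MeasurableSpace β] (g : Fin 2 × ℕ → β) : Measurable g :=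
  measurable_of_countable g

lemma measurable_comp_firstPair (g : Fin 2 × ℕ → ℝ) : Measurable fun z => g (firstPair z) :=
  (measurable_pairs g).comp measurable_firstPair

/-- The first sign and digit decouple from any function of the image point. -/
lemma integral_firstPair_mul (p : unitInterval) (g : Fin 2 × ℕ → ℝ) {h : (ℕ → Fin 2) × ℝ → ℝ}
    (hh : Measurable h) :
    ∫ z, g (firstPair z) * h (randomMap z) ∂productMeasure p =
      (∫ z, g (firstPair z) ∂productMeasure p) * ∫ z, h z ∂productMeasure p := by
  have h1 := ((indepFun_firstPair_randomMap p).comp (measurable_pairs g) hh)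
  have h2 := h1.integral_fun_mul_eq_mul_integral
    (measurable_comp_firstPair g).aestronglyMeasurable
    (hh.comp measurable_randomMap).aestronglyMeasurable
  have h3 := (measurePreserving_randomMap p)
  simp only [Function.comp_def] at h2
  rw [h2]
  congr 1
  conv_rhs => rw [← h3.map_eq]
  rw [integral_map measurable_randomMap.aemeasurable hh.aestronglyMeasurable]

lemma integral_comp_iterate (p : unitInterval) {h : (ℕ → Fin 2) × ℝ → ℝ} (hh : Measurable h)
    (n : ℕ) : ∫ z, h (randomMap^[n] z) ∂productMeasure p = ∫ z, h z ∂productMeasure p := by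
  have h3 := (measurePreserving_randomMap p).iterate n
  conv_rhs => rw [← h3.map_eq]
  rw [integral_map h3.measurable.aemeasurable hh.aestronglyMeasurable]

lemma iterate_snd_mem_genericPoints {z : (ℕ → Fin 2) × ℝ} (hz : z.2 ∈ genericPoints) (n : ℕ) :
    (randomMap^[n] z).2 ∈ genericPoints :=
  orbit_mem_genericPoints hz z.1 n

lemma two_le_firstPair {z : (ℕ → Fin 2) × ℝ} (hz : z.2 ∈ Ioc (0 : ℝ) 1) : 2 ≤ (firstPair z).2 :=
  (firstPair_spec z.1 hz).1

/-- Averages of centred functions of the digits, weighted by a bounded function of the image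
point, tend to `0`. -/
theorem ae_tendsto_average_centred (p : unitInterval) {g : Fin 2 × ℕ → ℝ}
    {h : (ℕ → Fin 2) × ℝ → ℝ} (hh : Measurable h) (hg : ∀ c : Fin 2 × ℕ, 2 ≤ c.2 → |g c| ≤ 1)
    (hb : ∀ z : (ℕ → Fin 2) × ℝ, z.2 ∈ Ioc (0 : ℝ) 1 → |h z| ≤ 1) :
    ∀ᵐ z ∂productMeasure p, Tendsto (fun n : ℕ => 1 / (n : ℝ) * ∑ i ∈ Finset.range n,
      (g (firstPair (randomMap^[i] z)) - ∫ w, g (firstPair w) ∂productMeasure p) *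
        h (randomMap^[i + 1] z)) atTop (𝓝 0) := by
  set m := ∫ w, g (firstPair w) ∂productMeasure p with hm
  have hgb : ∀ᵐ z ∂productMeasure p, |g (firstPair z)| ≤ 1 := by
    filter_upwards [ae_snd_mem_genericPoints p] with z hz
    exact hg _ (two_le_firstPair (genericPoints_subset hz))
  have hgi : Integrable (fun z => g (firstPair z)) (productMeasure p) :=
    integrable_of_ae_abs_le (measurable_comp_firstPair g) hgb
  have hmean : |m| ≤ 1 := by
    have := norm_integral_le_of_norm_le_const (f := fun z => g (firstPair z)) hgb
    simpa using this
  have hiter : ∀ n, Measurable (randomMap^[n]) := fun n => measurable_randomMap.iterate n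
  set W : (ℕ → Fin 2) × ℝ → ℝ := fun z => (g (firstPair z) - m) * h (randomMap z) with hW
  have hWm : Measurable W :=
    ((measurable_comp_firstPair g).sub_const m).mul (hh.comp measurable_randomMap)
  have hcent : ∫ z, (g (firstPair z) - m) ∂productMeasure p = 0 := by
    rw [integral_sub hgi (integrable_const _)]
    simp [hm]
  have := ae_tendsto_average_of_orthogonal (μ := productMeasure p)
    (Z := fun i z => W (randomMap^[i] z)) (C := 2) (fun i => hWm.comp (hiter i)) ?_ ?_
  · filter_upwards [this] with z hz
    refine hz.congr fun n => ?_
    simp only [hW, Function.iterate_succ_apply']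
  · filter_upwards [ae_snd_mem_genericPoints p] with z hz i
    have h1 := hg _ (two_le_firstPair (genericPoints_subset (iterate_snd_mem_genericPoints hz i)))
    have h2 := hb _ (genericPoints_subset (iterate_snd_mem_genericPoints hz (i + 1)))
    rw [Function.iterate_succ_apply'] at h2
    simp only [hW]
    rw [abs_mul]
    calc _ ≤ 2 * 1 := mul_le_mul ((abs_sub _ _).trans (by linarith)) h2 (abs_nonneg _) two_pos.le
      _ = 2 := mul_one 2
  · intro i j hij
    obtain ⟨k, rfl⟩ : ∃ k, j = k + 1 + i := ⟨j - i - 1, by omega⟩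
    have hprodm : Measurable fun z => W z * W (randomMap^[k + 1] z) :=
      hWm.mul (hWm.comp (hiter _))
    have h1 := integral_comp_iterate p hprodm i
    -- After stationarity moves time `i` to `0`, everything but the centred pair factor is a
    -- function of the image point. That factor decouples and integrates to `0`; `h` itself need not
    -- be centred.
    have h2 := integral_firstPair_mul p (fun c => g c - m)
      (h := fun z => h z * W (randomMap^[k] z)) (hh.mul (hWm.comp (hiter _)))
    rw [hcent, zero_mul] at h2
    simp only [Function.iterate_add_apply randomMap (k + 1) i]
    rw [h1, ← h2]
    refine integral_congr_ae (ae_of_all _ fun z => ?_)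
    simp only [hW, Function.iterate_succ_apply]
    ring

/-- The strong law of large numbers for functions of the digits. -/
theorem ae_tendsto_average_firstPair (p : unitInterval) {g : Fin 2 × ℕ → ℝ}
    (hg : Integrable (fun z => g (firstPair z)) (productMeasure p)) :
    ∀ᵐ z ∂productMeasure p, Tendsto (fun n : ℕ => 1 / (n : ℝ) * ∑ i ∈ Finset.range n,
      g (firstPair (randomMap^[i] z))) atTop (𝓝 (∫ z, g (firstPair z) ∂productMeasure p)) := by
  have hiter : ∀ n, MeasurePreserving (randomMap^[n]) (productMeasure p) (productMeasure p) :=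
    fun n => (measurePreserving_randomMap p).iterate n
  have hgm := measurable_comp_firstPair g
  -- A later pair is a function of the image point. Pairwise independence suffices for the strong
  -- law, which, unlike the orthogonal one, also covers unbounded integrable `g` such as the
  -- logarithm.
  have hlt : ∀ i k, IndepFun (fun z => g (firstPair (randomMap^[i] z)))
      (fun z => g (firstPair (randomMap^[k + 1 + i] z))) (productMeasure p) := by
    intro i k
    rw [indepFun_iff_measure_inter_preimage_eq_mul]
    intro U V hU hV
    have h1 := (indepFun_firstPair_randomMap p).comp (measurable_pairs g)
      (hgm.comp (hiter k).measurable)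
    rw [indepFun_iff_measure_inter_preimage_eq_mul] at h1
    have h2 : productMeasure p ((fun z => g (firstPair z)) ⁻¹' U ∩
        ((fun z => g (firstPair z)) ∘ randomMap^[k] ∘ randomMap) ⁻¹' V) =
        productMeasure p ((fun z => g (firstPair z)) ⁻¹' U) *
        productMeasure p (((fun z => g (firstPair z)) ∘ randomMap^[k] ∘ randomMap) ⁻¹' V) :=
      h1 U V hU hV
    have hUm := hgm hU
    have hVm := (hgm.comp ((hiter k).measurable.comp measurable_randomMap)) hV
    rw [← (hiter i).measure_preimage (hUm.inter hVm).nullMeasurableSet,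
      ← (hiter i).measure_preimage hUm.nullMeasurableSet,
      ← (hiter i).measure_preimage hVm.nullMeasurableSet] at h2
    simp only [Function.iterate_add_apply, Function.iterate_one]
    exact h2
  have hslln := strong_law_ae_real (μ := productMeasure p)
    (fun i z => g (firstPair (randomMap^[i] z))) hg ?_ ?_
  · filter_upwards [hslln] with z hz
    refine hz.congr fun n => ?_
    rw [div_eq_inv_mul, one_div]
  · intro i j hij
    rcases lt_or_gt_of_ne hij with h | h
    · obtain ⟨k, rfl⟩ : ∃ k, j = k + 1 + i := ⟨j - i - 1, by omega⟩
      exact hlt i k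
    · obtain ⟨k, rfl⟩ : ∃ k, i = k + 1 + j := ⟨i - j - 1, by omega⟩
      exact (hlt j k).symm
  · intro i
    refine ⟨(hgm.comp (hiter i).measurable).aemeasurable, hgm.aemeasurable, ?_⟩
    have : (fun z => g (firstPair (randomMap^[i] z))) =
      (fun z => g (firstPair z)) ∘ randomMap^[i] := rfl
    rw [this, ← Measure.map_map hgm (hiter i).measurable, (hiter i).map_eq]
    rfl

/-! ### The typical exponent -/

lemma letterMeasure_zero (p : unitInterval) :
    (letterMeasure p) {0} = ENNReal.ofReal (p : ℝ) := by
  rw [letterMeasure, bernoulliMeasure_apply_of_mem_of_notMem p (measurableSet_singleton _)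
    (mem_singleton _) (by simp), ENNReal.ofReal]
  congr 1
  ext
  simp [Real.coe_toNNReal _ p.2.1]

lemma letterMeasure_one (p : unitInterval) :
    (letterMeasure p) {1} = ENNReal.ofReal (1 - (p : ℝ)) := by
  rw [letterMeasure, bernoulliMeasure_apply_of_notMem_of_mem p (measurableSet_singleton _)
    (by simp) (mem_singleton _), ENNReal.ofReal]
  congr 1
  ext
  simp [Real.coe_toNNReal _ (sub_nonneg.2 p.2.2)]

lemma expansionFactor_nonneg (c : Fin 2 × ℕ) : 0 ≤ expansionFactor c := by
  rcases Nat.lt_or_ge c.2 2 with h | h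
  · have : c.2 = 0 ∨ c.2 = 1 := by omega
    rcases this with h | h <;> simp [expansionFactor, h]
  · exact (expansionFactor_pos h).le

/-- The expectation of a nonnegative function of the first sign and digit. -/
lemma integral_firstPair (p : unitInterval) {g : Fin 2 × ℕ → ℝ} (h0 : ∀ c, 0 ≤ g c) {A : ℝ}
    (hA : HasSum (fun n : ℕ => ((p : ℝ) * g (0, n) + (1 - p) * g (1, n)) *
      (1 / (n * ((n : ℝ) - 1)))) A) :
    Integrable (fun z => g (firstPair z)) (productMeasure p) ∧
      ∫ z, g (firstPair z) ∂productMeasure p = A := by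
  have hgm := measurable_comp_firstPair g
  have hp0 : 0 ≤ (p : ℝ) := p.2.1
  have hp1 : 0 ≤ 1 - (p : ℝ) := sub_nonneg.2 p.2.2
  have hterm : ∀ n : ℕ, 0 ≤ ((p : ℝ) * g (0, n) + (1 - p) * g (1, n)) *
      (1 / (n * ((n : ℝ) - 1))) := fun n =>
    mul_nonneg (add_nonneg (mul_nonneg hp0 (h0 _)) (mul_nonneg hp1 (h0 _)))
      (one_div_nonneg.2 (expansionFactor_nonneg (0, n)))
  have hA0 : 0 ≤ A := hA.nonneg hterm
  have hlint : ∫⁻ z, ENNReal.ofReal (g (firstPair z)) ∂productMeasure p = ENNReal.ofReal A := by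
    rw [← lintegral_map (f := fun c => ENNReal.ofReal (g c)) (measurable_pairs _)
      measurable_firstPair, lintegral_countable']
    simp_rw [Measure.map_apply measurable_firstPair (measurableSet_singleton _),
      measure_firstPair_preimage_singleton]
    rw [ENNReal.tsum_prod', tsum_fintype, Fin.sum_univ_two, ← ENNReal.tsum_add, ← hA.tsum_eq,
      ENNReal.ofReal_tsum_of_nonneg hterm hA.summable]
    refine tsum_congr fun n => ?_
    have hinv : 0 ≤ 1 / ((n : ℝ) * ((n : ℝ) - 1)) :=
      one_div_nonneg.2 (expansionFactor_nonneg (0, n))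
    rw [pairWeight, pairWeight, letterMeasure_zero, letterMeasure_one, expansionFactor,
      expansionFactor, ← ENNReal.ofReal_mul hp0, ← ENNReal.ofReal_mul hp1,
      ← ENNReal.ofReal_mul (h0 _), ← ENNReal.ofReal_mul (h0 _), ← ENNReal.ofReal_add
        (mul_nonneg (h0 _) (mul_nonneg hp0 hinv)) (mul_nonneg (h0 _) (mul_nonneg hp1 hinv))]
    congr 1
    ring
  constructor
  · refine ⟨hgm.aestronglyMeasurable, ?_⟩
    rw [hasFiniteIntegral_iff_ofReal (ae_of_all _ fun z => h0 _), hlint]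
    exact ENNReal.ofReal_lt_top
  · rw [integral_eq_lintegral_of_nonneg_ae (ae_of_all _ fun z => h0 _)
      hgm.aestronglyMeasurable, hlint, ENNReal.toReal_ofReal hA0]

/-- With `t = (k + 2) (k + 1)`, the bounds `log t ≤ 4 t^(1/4)` and `(k + 1)^(3/2) ≤ t^(3/4)`
dominate the terms by `4 / (k + 1)^(3/2)`. -/
lemma summable_typicalExponent : Summable fun k : ℕ =>
    Real.log (((k : ℝ) + 2) * ((k : ℝ) + 1)) / (((k : ℝ) + 2) * ((k : ℝ) + 1)) := by
  have hs : Summable fun k : ℕ => 4 * (1 / ((k + 1 : ℕ) : ℝ) ^ (3 / 2 : ℝ)) :=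
    (((Real.summable_one_div_nat_rpow (p := 3 / 2)).2 (by norm_num)).comp_injective
      (add_left_injective 1)).mul_left 4
  refine hs.of_nonneg_of_le (fun k => ?_) fun k => ?_
  · exact div_nonneg (Real.log_nonneg (by nlinarith [(k.cast_nonneg : (0 : ℝ) ≤ k)]))
      (by positivity)
  · set t : ℝ := ((k : ℝ) + 2) * ((k : ℝ) + 1) with ht
    have ht0 : 0 < t := by positivity
    have hk : (0 : ℝ) < (k : ℝ) + 1 := by positivity
    have h1 : Real.log t ≤ t ^ (1 / 4 : ℝ) / (1 / 4) :=
      Real.log_le_rpow_div ht0.le (by norm_num)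
    have h2 : ((k : ℝ) + 1) ^ (3 / 2 : ℝ) ≤ t ^ (3 / 4 : ℝ) := by
      have : ((k : ℝ) + 1) ^ (3 / 2 : ℝ) = (((k : ℝ) + 1) ^ (2 : ℝ)) ^ (3 / 4 : ℝ) := by
        rw [← Real.rpow_mul hk.le]; norm_num
      rw [this]
      refine Real.rpow_le_rpow (by positivity) ?_ (by norm_num)
      rw [Real.rpow_two, ht]
      nlinarith
    have h3 : t ^ (1 / 4 : ℝ) * t ^ (3 / 4 : ℝ) = t := by
      rw [← Real.rpow_add ht0]; norm_num
    push_cast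
    rw [div_le_iff₀ ht0]
    have h4 : (0 : ℝ) < ((k : ℝ) + 1) ^ (3 / 2 : ℝ) := by positivity
    have h5 : (0 : ℝ) < t ^ (1 / 4 : ℝ) := by positivity
    rw [mul_one_div, div_mul_eq_mul_div, le_div_iff₀ h4]
    calc Real.log t * ((k : ℝ) + 1) ^ (3 / 2 : ℝ)
        ≤ (t ^ (1 / 4 : ℝ) / (1 / 4)) * t ^ (3 / 4 : ℝ) := mul_le_mul h1 h2 h4.le (by positivity)
      _ = 4 * (t ^ (1 / 4 : ℝ) * t ^ (3 / 4 : ℝ)) := by ring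
      _ = 4 * t := by rw [h3]

lemma integral_log_expansionFactor (p : unitInterval) :
    Integrable (fun z => Real.log (expansionFactor (firstPair z))) (productMeasure p) ∧
      ∫ z, Real.log (expansionFactor (firstPair z)) ∂productMeasure p = typicalExponent := by
  refine integral_firstPair p (g := fun c => Real.log (expansionFactor c)) (fun c => ?_) ?_
  · rcases Nat.lt_or_ge c.2 2 with h | h
    · have : c.2 = 0 ∨ c.2 = 1 := by omega
      rcases this with h | h <;> simp [expansionFactor, h]
    · exact Real.log_nonneg (by linarith [two_le_expansionFactor h])
  -- The terms of `n = 0` and `n = 1` are zero because `1 / 0 = 0`, so the sum starts at digit `2`.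
  · have h := (hasSum_nat_add_iff (f := fun n : ℕ => ((p : ℝ) *
      Real.log (expansionFactor (0, n)) + (1 - p) * Real.log (expansionFactor (1, n))) *
      (1 / (n * ((n : ℝ) - 1)))) (g := typicalExponent) 2).1 ?_
    · simpa [Finset.sum_range_succ] using h
    · refine summable_typicalExponent.hasSum.congr_fun fun k => ?_
      simp only [expansionFactor]
      push_cast
      rw [show (k : ℝ) + 2 - 1 = k + 1 by ring]
      ring

lemma ae_tendsto_logFactorSum (p : unitInterval) : ∀ᵐ z ∂productMeasure p,
    Tendsto (fun n : ℕ => 1 / (n : ℝ) * logFactorSum z.1 z.2 n) atTop (𝓝 typicalExponent) := by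
  obtain ⟨h1, h2⟩ := integral_log_expansionFactor p
  have := ae_tendsto_average_firstPair p (g := fun c => Real.log (expansionFactor c)) h1
  rw [h2] at this
  exact this

lemma ae_hasLyapunovExponent (p : unitInterval) :
    ∀ᵐ z ∂productMeasure p, HasLyapunovExponent z.1 z.2 typicalExponent := by
  filter_upwards [ae_tendsto_logFactorSum p, ae_snd_mem_genericPoints p] with z h1 h2
  exact hasLyapunovExponent_of_tendsto (genericPoints_subset h2)
    (fun i => not_isPartitionPoint_of_generic (orbit_mem_genericPoints h2 _ i)) h1

lemma ae_hasRate (p : unitInterval) :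
    ∀ᵐ z ∂productMeasure p, HasRate z.1 z.2 (-typicalExponent) := by
  filter_upwards [ae_tendsto_logFactorSum p, ae_snd_mem_genericPoints p] with z h1 h2
  exact hasRate_of_tendsto (genericPoints_subset h2) h1

/-! ### Expectation and averages of the approximation coefficients -/

lemma hasSum_telescope : HasSum (fun n : ℕ => 1 / ((n : ℝ) + 1) - 1 / ((n : ℝ) + 2)) 1 := by
  rw [hasSum_iff_tendsto_nat_of_nonneg]
  · have h : ∀ n : ℕ, ∑ i ∈ Finset.range n, (1 / ((i : ℝ) + 1) - 1 / ((i : ℝ) + 2)) =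
        1 - 1 / ((n : ℝ) + 1) := by
      intro n
      induction n with
      | zero => simp
      | succ n ih => rw [Finset.sum_range_succ, ih]; push_cast; ring
    simp_rw [h]
    simpa using tendsto_one_div_add_atTop_nhds_zero_nat.const_sub (1 : ℝ)
  · intro n
    exact sub_nonneg.2 (one_div_le_one_div_of_le (by positivity) (by linarith))

lemma riemannZeta_two_re : (riemannZeta 2).re = Real.pi ^ 2 / 6 := by
  rw [riemannZeta_two]
  have : ((Real.pi : ℂ) ^ 2 / 6) = ((Real.pi ^ 2 / 6 : ℝ) : ℂ) := by push_cast; rfl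
  rw [this, Complex.ofReal_re]

lemma hasSum_inv_sq : HasSum (fun n : ℕ => 1 / ((n : ℝ) + 1) ^ 2) (riemannZeta 2).re := by
  rw [riemannZeta_two_re]
  have h := hasSum_zeta_two
  rw [← hasSum_nat_add_iff' 1] at h
  simpa using h

lemma hasSum_inv_sq_succ :
    HasSum (fun n : ℕ => 1 / ((n : ℝ) + 2) ^ 2) ((riemannZeta 2).re - 1) := by
  have h := hasSum_inv_sq
  rw [← hasSum_nat_add_iff' 1] at h
  simp only [Finset.sum_range_one, Nat.cast_zero, zero_add, one_pow, div_one] at h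
  refine h.congr_fun fun n => ?_
  push_cast
  ring

/-- Partial fractions: each term is `1 / (n + 1) ^ 2` minus a telescoping term. For digit `d = n +
2` and sign `0` it is the factor `1 / (d - 1)` times the length of the cell; sign `1` has the factor
`1 / d`. -/
lemma hasSum_thetaFactor_zero :
    HasSum (fun n : ℕ => 1 / (((n : ℝ) + 2) * ((n : ℝ) + 1) ^ 2)) ((riemannZeta 2).re - 1) := by
  refine (hasSum_inv_sq.sub hasSum_telescope).congr_fun fun n => ?_
  field_simp
  ring

lemma hasSum_thetaFactor_one :
    HasSum (fun n : ℕ => 1 / (((n : ℝ) + 2) ^ 2 * ((n : ℝ) + 1))) (2 - (riemannZeta 2).re) := by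
  have h := hasSum_telescope.sub hasSum_inv_sq_succ
  rw [show 1 - ((riemannZeta 2).re - 1) = 2 - (riemannZeta 2).re by ring] at h
  refine h.congr_fun fun n => ?_
  field_simp
  ring

lemma integral_thetaFactor (p : unitInterval) :
    Integrable (fun z => thetaFactor (firstPair z)) (productMeasure p) ∧
      ∫ z, thetaFactor (firstPair z) ∂productMeasure p = 2 * meanTheta p := by
  refine integral_firstPair p (fun c => ?_) ?_
  · rcases Nat.lt_or_ge c.2 2 with h | h
    · have : c.2 = 0 ∨ c.2 = 1 := by omega
      rcases this with h | h <;> simp [thetaFactor, expansionFactor, h]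
    · exact (thetaFactor_mem h).1
  · have h := (hasSum_nat_add_iff (f := fun n : ℕ => ((p : ℝ) *
      thetaFactor (0, n) + (1 - p) * thetaFactor (1, n)) *
      (1 / (n * ((n : ℝ) - 1)))) (g := 2 * meanTheta p) 2).1 ?_
    · simpa [Finset.sum_range_succ] using h
    · have h1 := (hasSum_thetaFactor_zero.mul_left (p : ℝ)).add
        (hasSum_thetaFactor_one.mul_left (1 - (p : ℝ)))
      rw [show (p : ℝ) * ((riemannZeta 2).re - 1) + (1 - p) * (2 - (riemannZeta 2).re) =
        2 * meanTheta p by rw [meanTheta]; ring] at h1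
      refine h1.congr_fun fun n => ?_
      simp only [thetaFactor, expansionFactor, Fin.val_zero, Fin.val_one]
      push_cast
      rw [show (n : ℝ) + 2 - 1 = n + 1 by ring]
      field_simp
      ring

lemma integral_snd (p : unitInterval) : ∫ z, z.2 ∂productMeasure p = 1 / 2 := by
  have h : (productMeasure p).map Prod.snd = unitVolume := by
    rw [productMeasure, Measure.map_snd_prod, measure_univ, one_smul]
  have h1 : ∫ x, x ∂unitVolume = 1 / 2 := by
    rw [unitVolume, integral_Icc_eq_integral_Ioc, ← intervalIntegral.integral_of_le zero_le_one,
      integral_id]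
    norm_num
  rw [← h1, ← h, integral_map measurable_snd.aemeasurable measurable_id'.aestronglyMeasurable]

lemma integrable_snd (p : unitInterval) :
    Integrable (fun z : (ℕ → Fin 2) × ℝ => z.2) (productMeasure p) := by
  refine integrable_of_ae_abs_le (C := 1) measurable_snd ?_
  filter_upwards [ae_snd_mem_genericPoints p] with z hz
  rw [abs_of_pos hz.2.1]
  exact hz.2.2.le

lemma theta_eq_iterate {z : (ℕ → Fin 2) × ℝ} (hz : z.2 ∈ Ioc (0 : ℝ) 1) (n : ℕ) :
    theta z.1 z.2 n = thetaFactor (firstPair (randomMap^[n] z)) * (randomMap^[n + 1] z).2 :=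
  theta_eq hz n

/-- Every approximation coefficient has the same expectation. -/
lemma integral_theta (p : unitInterval) (n : ℕ) :
    Integrable (fun z : (ℕ → Fin 2) × ℝ => theta z.1 z.2 n) (productMeasure p) ∧
      ∫ z, theta z.1 z.2 n ∂productMeasure p = meanTheta p := by
  set f : (ℕ → Fin 2) × ℝ → ℝ := fun z => thetaFactor (firstPair z) * (randomMap z).2 with hf
  have hfm : Measurable f :=
    (measurable_comp_firstPair _).mul (measurable_snd.comp measurable_randomMap)
  have hiter := (measurePreserving_randomMap p).iterate n
  have heq : (fun z : (ℕ → Fin 2) × ℝ => theta z.1 z.2 n) =ᵐ[productMeasure p]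
      fun z => f (randomMap^[n] z) := by
    filter_upwards [ae_snd_mem_genericPoints p] with z hz
    rw [theta_eq_iterate (genericPoints_subset hz), Function.iterate_succ_apply']
  constructor
  · refine Integrable.congr ?_ heq.symm
    refine integrable_of_ae_abs_le (C := 1) (hfm.comp hiter.measurable) ?_
    filter_upwards [ae_snd_mem_genericPoints p] with z hz
    have h1 := genericPoints_subset (iterate_snd_mem_genericPoints hz n)
    have h2 := genericPoints_subset (iterate_snd_mem_genericPoints hz (n + 1))
    rw [Function.iterate_succ_apply'] at h2
    have h3 := thetaFactor_mem (two_le_firstPair h1)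
    simp only [hf]
    rw [abs_of_nonneg (mul_nonneg h3.1 h2.1.le)]
    exact mul_le_one₀ h3.2 h2.1.le h2.2
  -- Stationarity reduces to the first step, where independence gives `2 * meanTheta p` times the
  -- mean `1/2` of Lebesgue measure.
  · rw [integral_congr_ae heq, integral_comp_iterate p hfm,
      integral_firstPair_mul p thetaFactor measurable_snd, (integral_thetaFactor p).2, integral_snd]
    ring

/-- The integrated form of the identity between a point and its image. -/
lemma integral_branchOffset_add (p : unitInterval) :
    ∫ z, branchOffset (firstPair z) ∂productMeasure p +
      (∫ z, branchSlope (firstPair z) ∂productMeasure p) * (1 / 2) = 1 / 2 := by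
  have h1 : (fun z : (ℕ → Fin 2) × ℝ => z.2) =ᵐ[productMeasure p] fun z =>
      branchOffset (firstPair z) + branchSlope (firstPair z) * (randomMap z).2 := by
    filter_upwards [ae_snd_mem_genericPoints p] with z hz
    exact (firstPair_spec z.1 (genericPoints_subset hz)).2.2
  have hb : Integrable (fun z => branchOffset (firstPair z)) (productMeasure p) := by
    refine integrable_of_ae_abs_le (C := 1) (measurable_comp_firstPair _) ?_
    filter_upwards [ae_snd_mem_genericPoints p] with z hz
    have := branchOffset_mem (two_le_firstPair (genericPoints_subset hz))
    rw [abs_of_nonneg this.1]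
    exact this.2
  have he : Integrable (fun z => branchSlope (firstPair z) * (randomMap z).2)
      (productMeasure p) := by
    have := (integrable_snd p).sub hb
    refine this.congr ?_
    filter_upwards [h1] with z hz
    simp only [Pi.sub_apply]
    linarith
  have h2 := integral_congr_ae h1
  rw [integral_add hb he, integral_firstPair_mul p branchSlope measurable_snd, integral_snd] at h2
  exact h2.symm

/-- Makes `1 - e` nonzero, where `e` is the mean slope, so that the averaged one-step identity can
be solved for the average of the orbit. -/
lemma abs_integral_branchSlope_le (p : unitInterval) :
    |∫ z, branchSlope (firstPair z) ∂productMeasure p| ≤ 1 / 2 := by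
  have := norm_integral_le_of_norm_le_const (μ := productMeasure p) (C := 1 / 2)
    (f := fun z => branchSlope (firstPair z)) (by
      filter_upwards [ae_snd_mem_genericPoints p] with z hz
      exact abs_branchSlope_le (two_le_firstPair (genericPoints_subset hz)))
  simpa using this

/-- The averages of the points along typical random orbits tend to `1 / 2`. -/
lemma ae_tendsto_average_snd (p : unitInterval) : ∀ᵐ z ∂productMeasure p,
    Tendsto (fun n : ℕ => 1 / (n : ℝ) * ∑ i ∈ Finset.range n, (randomMap^[i + 1] z).2)
      atTop (𝓝 (1 / 2)) := by
  set b := ∫ z, branchOffset (firstPair z) ∂productMeasure p with hb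
  set e := ∫ z, branchSlope (firstPair z) ∂productMeasure p with he
  have hbe : b + e * (1 / 2) = 1 / 2 := integral_branchOffset_add p
  have he2 : |e| ≤ 1 / 2 := abs_integral_branchSlope_le p
  have he1 : 1 - e ≠ 0 := by linarith [le_abs_self e]
  have t2 := ae_tendsto_average_centred p (g := branchOffset) (h := fun _ => 1) measurable_const
    (fun c hc => by rw [abs_of_nonneg (branchOffset_mem hc).1]; exact (branchOffset_mem hc).2)
    (fun z _ => by simp)
  have t3 := ae_tendsto_average_centred p (g := branchSlope) (h := fun z => z.2) measurable_snd
    (fun c hc => (abs_branchSlope_le hc).trans (by norm_num))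
    (fun z hz => by rw [abs_of_pos hz.1]; exact hz.2)
  filter_upwards [t2, t3, ae_snd_mem_genericPoints p] with z h2 h3 hz
  rw [← hb] at h2
  rw [← he] at h3
  have hmem : ∀ n, (randomMap^[n] z).2 ∈ Ioc (0 : ℝ) 1 := fun n =>
    genericPoints_subset (iterate_snd_mem_genericPoints hz n)
  have hbd : Tendsto (fun n : ℕ => 1 / (n : ℝ) * ((randomMap^[n] z).2 - z.2)) atTop (𝓝 0) := by
    refine squeeze_zero_norm (fun n => ?_) tendsto_one_div_atTop_nhds_zero_nat
    rw [norm_mul, Real.norm_eq_abs, Real.norm_eq_abs,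
      abs_of_nonneg (show (0 : ℝ) ≤ 1 / (n : ℝ) by positivity)]
    have h4 := hmem n
    have h5 := hmem 0
    simp only [Function.iterate_zero, id] at h5
    refine mul_le_of_le_one_right (by positivity) (abs_le.2 ⟨?_, ?_⟩) <;>
      linarith [h4.1, h4.2, h5.1, h5.2]
  -- Averaging `y_i = β_i + ε_i y_{i+1}` gives `A = b + e A` up to the two centred averages and the
  -- boundary term `(y_n - y_0) / n`. Hence `A` tends to `b / (1 - e)`, which is `1/2`.
  have hkey := ((((h2.add h3).add hbd).add_const b).div_const (1 - e))
  have hlim : (0 + 0 + 0 + b) / (1 - e) = 1 / 2 := by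
    rw [div_eq_iff he1]; linarith
  rw [hlim] at hkey
  refine hkey.congr' ?_
  filter_upwards [eventually_ge_atTop 1] with n hn
  have hn0 : (n : ℝ) ≠ 0 := by positivity
  have hstep : ∀ i, (randomMap^[i] z).2 = branchOffset (firstPair (randomMap^[i] z)) +
      branchSlope (firstPair (randomMap^[i] z)) * (randomMap^[i + 1] z).2 := by
    intro i
    rw [Function.iterate_succ_apply']
    exact (firstPair_spec _ (hmem i)).2.2
  have htel : ∑ i ∈ Finset.range n, (randomMap^[i + 1] z).2 - ∑ i ∈ Finset.range n,
      (randomMap^[i] z).2 = (randomMap^[n] z).2 - z.2 := by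
    rw [← Finset.sum_sub_distrib, Finset.sum_range_sub (fun i => (randomMap^[i] z).2)]
    rfl
  have hsum : ∑ i ∈ Finset.range n, (randomMap^[i] z).2 =
      ∑ i ∈ Finset.range n, branchOffset (firstPair (randomMap^[i] z)) +
      ∑ i ∈ Finset.range n,
        branchSlope (firstPair (randomMap^[i] z)) * (randomMap^[i + 1] z).2 := by
    rw [← Finset.sum_add_distrib]
    exact Finset.sum_congr rfl fun i _ => hstep i
  rw [div_eq_iff he1]
  simp only [mul_one, sub_mul, Finset.sum_sub_distrib, ← Finset.mul_sum, Finset.sum_const,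
    Finset.card_range, nsmul_eq_mul]
  rw [← htel, hsum]
  field_simp
  ring

/-- The averages of the approximation coefficients converge to their expectation. -/
lemma ae_tendsto_average_theta (p : unitInterval) : ∀ᵐ z ∂productMeasure p,
    Tendsto (fun n : ℕ => 1 / (n : ℝ) * ∑ i ∈ Finset.range n, theta z.1 z.2 i)
      atTop (𝓝 (meanTheta p)) := by
  have t1 := ae_tendsto_average_centred p (g := thetaFactor) (h := fun z => z.2) measurable_snd
    (fun c hc => by rw [abs_of_nonneg (thetaFactor_mem hc).1]; exact (thetaFactor_mem hc).2)
    (fun z hz => by rw [abs_of_pos hz.1]; exact hz.2)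
  rw [(integral_thetaFactor p).2] at t1
  filter_upwards [t1, ae_tendsto_average_snd p, ae_snd_mem_genericPoints p] with z h1 h2 hz
  -- The pair factor is replaced by its mean `2 * meanTheta p`, and the orbit then contributes its
  -- average `1/2`.
  have h3 := h1.add (h2.const_mul (2 * meanTheta p))
  rw [show 0 + 2 * meanTheta (p : ℝ) * (1 / 2) = meanTheta p by ring] at h3
  refine h3.congr fun n => ?_
  simp only [theta_eq_iterate (genericPoints_subset hz), sub_mul, Finset.sum_sub_distrib,
    ← Finset.mul_sum]
  ring

/-! ### The moments of the two distribution functions -/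

/-- The integral of the hat function `max 0 (1 - c z)`. -/
lemma integral_hat {c : ℝ} (hc : 1 ≤ c) :
    ∫ z in Icc (0 : ℝ) 1, max 0 (1 - c * z) = 1 / (2 * c) := by
  have hc0 : 0 < c := by linarith
  have hcont : Continuous fun z : ℝ => max 0 (1 - c * z) := by fun_prop
  rw [integral_Icc_eq_integral_Ioc, ← intervalIntegral.integral_of_le zero_le_one,
    ← intervalIntegral.integral_add_adjacent_intervals (b := 1 / c)
      (hcont.intervalIntegrable _ _) (hcont.intervalIntegrable _ _)]
  have h1 : ∫ z in (0 : ℝ)..1 / c, max 0 (1 - c * z) = ∫ z in (0 : ℝ)..1 / c, (1 - c * z) := by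
    refine intervalIntegral.integral_congr fun z hz => ?_
    rw [uIcc_of_le (by positivity)] at hz
    have := hz.2
    rw [le_div_iff₀ hc0] at this
    exact max_eq_right (by linarith)
  have h2 : ∫ z in (1 / c)..1, max 0 (1 - c * z) = 0 := by
    rw [intervalIntegral.integral_congr (g := fun _ => (0 : ℝ))]
    · simp
    · intro z hz
      rw [uIcc_of_le (by rw [div_le_one hc0]; exact hc)] at hz
      have := hz.1
      rw [div_le_iff₀ hc0] at this
      exact max_eq_left (by linarith)
  have hlin : Continuous fun z : ℝ => c * z := by fun_prop
  rw [h1, h2, intervalIntegral.integral_sub (by simp) (hlin.intervalIntegrable _ _),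
    intervalIntegral.integral_const_mul, integral_id]
  simp
  field_simp
  norm_num

/-- Integration of a mixture of hat functions. -/
lemma integral_of_hasSum_hat {F : ℝ → ℝ} {w c : ℕ → ℝ} {S : ℝ} (hw : ∀ n, 0 ≤ w n)
    (hc : ∀ n, 1 ≤ c n) (hS : HasSum (fun n => w n * (1 / (2 * c n))) S)
    (hF : ∀ z ∈ Ioc (0 : ℝ) 1, HasSum (fun n => w n * max 0 (1 - c n * z)) (F z)) :
    ∫ z in Icc (0 : ℝ) 1, F z = S := by
  have hint : ∀ n, IntegrableOn (fun z : ℝ => w n * max 0 (1 - c n * z)) (Icc 0 1) volume := by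
    intro n
    have : Continuous fun z : ℝ => w n * max 0 (1 - c n * z) := by fun_prop
    exact this.continuousOn.integrableOn_Icc
  have hval : ∀ n, ∫ z in Icc (0 : ℝ) 1, w n * max 0 (1 - c n * z) = w n * (1 / (2 * c n)) := by
    intro n
    rw [integral_const_mul, integral_hat (hc n)]
  have h := hasSum_integral_of_summable_integral_norm hint (by
    refine hS.summable.congr fun n => ?_
    rw [← hval]
    refine integral_congr_ae (ae_of_all _ fun z => ?_)
    exact (Real.norm_of_nonneg (mul_nonneg (hw n) (le_max_left _ _))).symm)
  simp only [hval] at h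
  rw [hS.unique h, integral_Icc_eq_integral_Ioc, integral_Icc_eq_integral_Ioc]
  exact setIntegral_congr_fun measurableSet_Ioc fun z hz => (hF z hz).tsum_eq.symm

lemma floor_one_div_spec {z : ℝ} (hz : z ∈ Ioc (0 : ℝ) 1) :
    1 ≤ ⌊1 / z⌋₊ ∧ ⌊1 / z⌋₊ * z ≤ 1 ∧ 1 < ((⌊1 / z⌋₊ : ℝ) + 1) * z := by
  have h0 := hz.1
  refine ⟨?_, ?_, ?_⟩
  · rw [Nat.one_le_floor_iff, le_div_iff₀ h0]; linarith [hz.2]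
  · rw [← le_div_iff₀ h0]; exact Nat.floor_le (by positivity)
  · rw [← div_lt_iff₀ h0]; exact Nat.lt_floor_add_one _

/-- Digit `n + 2` has probability `1 / ((n + 2) (n + 1))`, and for sign `0` the coefficient is then
uniform on `[0, 1 / (n + 1)]`; the hat is its tail probability. Terms with `n ≥ ⌊1 / z⌋` vanish and
the rest telescope. -/
lemma hasSum_one_sub_distL {z : ℝ} (hz : z ∈ Ioc (0 : ℝ) 1) :
    HasSum (fun n : ℕ => 1 / (((n : ℝ) + 2) * ((n : ℝ) + 1)) * max 0 (1 - ((n : ℝ) + 1) * z))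
      (1 - distL z) := by
  obtain ⟨h1, h2, h3⟩ := floor_one_div_spec hz
  have h0 := hz.1
  rw [distL]
  set m := ⌊1 / z⌋₊
  have hsum := hasSum_sum_of_ne_finset_zero (L := .unconditional ℕ) (s := Finset.range m) (f := fun n : ℕ =>
    1 / (((n : ℝ) + 2) * ((n : ℝ) + 1)) * max 0 (1 - ((n : ℝ) + 1) * z)) (fun n hn => by
      have hmn : (m : ℝ) ≤ n := by
        exact_mod_cast not_lt.1 fun h => hn (Finset.mem_range.2 h)
      rw [max_eq_left (by nlinarith), mul_zero])
  convert hsum using 1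
  have hterm : ∀ n ∈ Finset.range m,
      1 / (((n : ℝ) + 2) * ((n : ℝ) + 1)) * max 0 (1 - ((n : ℝ) + 1) * z) =
        1 / ((n : ℝ) + 1) - 1 / ((n : ℝ) + 2) - z / ((n : ℝ) + 2) := by
    intro n hn
    have hmn : (n : ℝ) + 1 ≤ m := by exact_mod_cast Finset.mem_range.1 hn
    rw [max_eq_right (by nlinarith)]
    field_simp
    ring
  rw [Finset.sum_congr rfl hterm]
  -- The remaining identity is algebraic, so `m` is freed from `z` and induction applies.
  have hgen : ∀ m : ℕ, 1 - (∑ k ∈ Finset.Icc 2 (m + 1), z / (k : ℝ) + 1 / ((m : ℝ) + 1)) =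
      ∑ n ∈ Finset.range m, (1 / ((n : ℝ) + 1) - 1 / ((n : ℝ) + 2) - z / ((n : ℝ) + 2)) := by
    intro m
    induction m with
    | zero => simp
    | succ m ih =>
      rw [Finset.sum_range_succ, ← ih, Finset.sum_Icc_succ_top (by omega)]
      push_cast
      ring
  exact hgen m

lemma hasSum_one_sub_distA {z : ℝ} (hz : z ∈ Ioc (0 : ℝ) 1) :
    HasSum (fun n : ℕ => 1 / (((n : ℝ) + 2) * ((n : ℝ) + 1)) * max 0 (1 - ((n : ℝ) + 2) * z))
      (1 - distA z) := by
  obtain ⟨h1, h2, h3⟩ := floor_one_div_spec hz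
  have h0 := hz.1
  rw [distA]
  -- For sign `1` the hat has slope `n + 2`, so the terms vanish one index earlier, from `⌊1 / z⌋ -
  -- 1` on.
  obtain ⟨m, hm⟩ : ∃ m, ⌊1 / z⌋₊ = m + 1 := ⟨⌊1 / z⌋₊ - 1, by omega⟩
  rw [hm] at h2 h3 ⊢
  push_cast at h2 h3
  have hsum := hasSum_sum_of_ne_finset_zero (L := .unconditional ℕ) (s := Finset.range m) (f := fun n : ℕ =>
    1 / (((n : ℝ) + 2) * ((n : ℝ) + 1)) * max 0 (1 - ((n : ℝ) + 2) * z)) (fun n hn => by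
      have hmn : (m : ℝ) ≤ n := by
        exact_mod_cast not_lt.1 fun h => hn (Finset.mem_range.2 h)
      rw [max_eq_left (by nlinarith), mul_zero])
  convert hsum using 1
  have hterm : ∀ n ∈ Finset.range m,
      1 / (((n : ℝ) + 2) * ((n : ℝ) + 1)) * max 0 (1 - ((n : ℝ) + 2) * z) =
        1 / ((n : ℝ) + 1) - 1 / ((n : ℝ) + 2) - z / ((n : ℝ) + 1) := by
    intro n hn
    have hmn : (n : ℝ) + 1 ≤ m := by exact_mod_cast Finset.mem_range.1 hn
    rw [max_eq_right (by nlinarith)]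
    field_simp
    ring
  rw [Finset.sum_congr rfl hterm]
  have hgen : ∀ m : ℕ, 1 - (∑ k ∈ Finset.Icc 2 (m + 1), z / ((k : ℝ) - 1) +
      1 / ((m + 1 : ℕ) : ℝ)) =
      ∑ n ∈ Finset.range m, (1 / ((n : ℝ) + 1) - 1 / ((n : ℝ) + 2) - z / ((n : ℝ) + 1)) := by
    intro m
    induction m with
    | zero => simp
    | succ m ih =>
      rw [Finset.sum_range_succ, ← ih, Finset.sum_Icc_succ_top (by omega)]
      push_cast
      ring
  exact hgen m

lemma momentL_eq : momentL = meanTheta 1 := by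
  refine integral_of_hasSum_hat (w := fun n : ℕ => 1 / (((n : ℝ) + 2) * ((n : ℝ) + 1)))
    (c := fun n : ℕ => (n : ℝ) + 1) (fun n => by positivity) (fun n => by simp) ?_
    fun z hz => hasSum_one_sub_distL hz
  have h := hasSum_thetaFactor_zero.mul_left (1 / 2)
  rw [show 1 / 2 * ((riemannZeta 2).re - 1) = meanTheta 1 by rw [meanTheta]; ring] at h
  refine h.congr_fun fun n => ?_
  field_simp

lemma momentA_eq : momentA = meanTheta 0 := by
  refine integral_of_hasSum_hat (w := fun n : ℕ => 1 / (((n : ℝ) + 2) * ((n : ℝ) + 1)))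
    (c := fun n : ℕ => (n : ℝ) + 2) (fun n => by positivity)
    (fun n => by linarith [(n.cast_nonneg : (0 : ℝ) ≤ n)]) ?_ fun z hz => hasSum_one_sub_distA hz
  have h := hasSum_thetaFactor_one.mul_left (1 / 2)
  rw [show 1 / 2 * (2 - (riemannZeta 2).re) = meanTheta 0 by rw [meanTheta]; ring] at h
  refine h.congr_fun fun n => ?_
  field_simp

/-- `M_q` is affine in `q`, with positive slope since `ζ(2) = π² / 6 > 3/2` follows from `π > 3`;
its end values are the two moments. -/
lemma image_meanTheta : meanTheta '' Icc (0 : ℝ) 1 = Icc momentA momentL := by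
  rw [momentA_eq, momentL_eq]
  set s := (2 * (riemannZeta 2).re - 3) / 2 with hs
  have hs0 : 0 < s := by
    rw [hs, riemannZeta_two_re]
    have := Real.pi_gt_three
    nlinarith
  have hM : ∀ q, meanTheta q = s * q + meanTheta 0 := fun q => by
    simp only [meanTheta, ← hs]; ring
  have h : meanTheta = fun q => s * q + meanTheta 0 := funext hM
  rw [h, image_affine_Icc' hs0]

/-! ### Universality and uncountably many expansions -/

/-- The set of points whose expansion starts with a given block. -/
def blockSet (b : List (Fin 2 × ℕ)) : Set ((ℕ → Fin 2) × ℝ) :=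
  {z | ∀ (i : ℕ) (hi : i < b.length), firstPair (randomMap^[i] z) = b[i]}

lemma blockSet_nil : blockSet [] = univ := by
  ext z
  simp [blockSet]

lemma blockSet_cons (c : Fin 2 × ℕ) (b : List (Fin 2 × ℕ)) :
    blockSet (c :: b) = firstPair ⁻¹' {c} ∩ randomMap ⁻¹' blockSet b := by
  ext z
  constructor
  · intro h
    refine ⟨h 0 (by simp), fun i hi => ?_⟩
    have := h (i + 1) (by simpa using hi)
    simpa [Function.iterate_succ_apply] using this
  · rintro ⟨h0, h1⟩ i hi
    cases i with
    | zero => exact h0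
    | succ i =>
      have := h1 i (by simpa using hi)
      simpa [Function.iterate_succ_apply] using this

lemma measurableSet_blockSet (b : List (Fin 2 × ℕ)) : MeasurableSet (blockSet b) := by
  induction b with
  | nil => rw [blockSet_nil]; exact .univ
  | cons c b ih =>
    rw [blockSet_cons]
    exact (measurable_firstPair (measurableSet_singleton c)).inter (measurable_randomMap ih)

/-- The initial block is independent of the remaining orbit. -/
lemma measure_blockSet_inter (p : unitInterval) (b : List (Fin 2 × ℕ))
    {S : Set ((ℕ → Fin 2) × ℝ)} (hS : MeasurableSet S) :
    productMeasure p (blockSet b ∩ randomMap^[b.length] ⁻¹' S) =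
      (b.map (pairWeight p)).prod * productMeasure p S := by
  induction b with
  | nil => simp [blockSet_nil]
  | cons c b ih =>
    have : blockSet (c :: b) ∩ randomMap^[(c :: b).length] ⁻¹' S =
        firstPair ⁻¹' {c} ∩ randomMap ⁻¹' (blockSet b ∩ randomMap^[b.length] ⁻¹' S) := by
      rw [blockSet_cons, List.length_cons, Function.iterate_succ, inter_assoc, preimage_inter]
      rfl
    rw [this, measure_firstPair_inter_preimage_singleton p c ((measurableSet_blockSet b).inter
      ((measurable_randomMap.iterate _) hS)), ih, List.map_cons, List.prod_cons, mul_assoc]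

lemma pairWeight_ne_zero {p : unitInterval} (hp0 : 0 < p) (hp1 : p < 1) {c : Fin 2 × ℕ}
    (hc : 2 ≤ c.2) : pairWeight p c ≠ 0 := by
  have h0 : 0 < (p : ℝ) := hp0
  have h1 : (p : ℝ) < 1 := hp1
  refine mul_ne_zero ?_ ?_
  · rcases Fin.exists_fin_two.1 ⟨c.1, rfl⟩ with h | h
    · rw [h, letterMeasure_zero]; simpa using h0
    · rw [h, letterMeasure_one]; simpa using h1
  · simpa using expansionFactor_pos hc

/-- Let `N` be the set of points that miss the block at all multiples of its length `L`. It lies in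
the preimage of `N` under the `L`-th iterate, outside the block set. That preimage has the measure
of `N` and is independent of the block, so `μ N ≤ (1 - w) μ N` with block weight `w > 0`, and `N` is
null. -/
lemma ae_exists_block {p : unitInterval} (hp0 : 0 < p) (hp1 : p < 1) {b : List (Fin 2 × ℕ)}
    (hb : ∀ c ∈ b, 2 ≤ c.2) :
    ∀ᵐ z ∂productMeasure p, ∃ k, randomMap^[k] z ∈ blockSet b := by
  set L := b.length with hL
  set N : Set ((ℕ → Fin 2) × ℝ) := {z | ∀ j, randomMap^[j * L] z ∉ blockSet b} with hN
  have hNm : MeasurableSet N := by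
    have : N = ⋂ j, (randomMap^[j * L] ⁻¹' blockSet b)ᶜ := by ext z; simp [hN]
    rw [this]
    exact MeasurableSet.iInter fun j =>
      ((measurable_randomMap.iterate _) (measurableSet_blockSet b)).compl
  have hpos : (b.map (pairWeight p)).prod ≠ 0 := by
    rw [Ne, List.prod_eq_zero_iff, List.mem_map]
    rintro ⟨c, hc, h⟩
    exact pairWeight_ne_zero hp0 hp1 (hb c hc) h
  have hsub : N ⊆ randomMap^[L] ⁻¹' N \ blockSet b := by
    intro z hz
    refine ⟨fun j => ?_, by simpa using hz 0⟩
    rw [← Function.iterate_add_apply, ← Nat.succ_mul]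
    exact hz (j + 1)
  have hpre := ((measurePreserving_randomMap p).iterate L).measure_preimage hNm.nullMeasurableSet
  have hsplit := measure_inter_add_sdiff (μ := productMeasure p) (randomMap^[L] ⁻¹' N)
    (measurableSet_blockSet b)
  rw [inter_comm, measure_blockSet_inter p b hNm, hpre] at hsplit
  have hle : (b.map (pairWeight p)).prod * productMeasure p N + productMeasure p N ≤
      0 + productMeasure p N := by
    rw [zero_add]
    conv_rhs => rw [← hsplit]
    exact add_le_add le_rfl (measure_mono hsub)
  have hzero : productMeasure p N = 0 := by
    have h1 := (ENNReal.add_le_add_iff_right (measure_ne_top _ _)).1 hle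
    exact (mul_eq_zero.1 (le_antisymm h1 zero_le)).resolve_left hpos
  rw [ae_iff]
  refine measure_mono_null (fun z hz => ?_) hzero
  intro j hj
  exact hz ⟨_, hj⟩

/-- Typical expansions are universal. -/
lemma ae_isUniversal {p : unitInterval} (hp0 : 0 < p) (hp1 : p < 1) :
    ∀ᵐ z ∂productMeasure p, IsUniversal (expansion z.1 z.2) := by
  have h : ∀ b : List (Fin 2 × ℕ), ∀ᵐ z ∂productMeasure p, (∀ c ∈ b, 2 ≤ c.2) →
      ∃ k, randomMap^[k] z ∈ blockSet b := by
    intro b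
    by_cases hb : ∀ c ∈ b, 2 ≤ c.2
    · filter_upwards [ae_exists_block hp0 hp1 hb] with z hz _ using hz
    · exact ae_of_all _ fun z hz => absurd hz hb
  filter_upwards [ae_all_iff.2 h] with z hz b hb
  obtain ⟨k, hk⟩ := hz b hb
  refine ⟨k, fun i hi => ?_⟩
  rw [expansion_eq, add_comm, Function.iterate_add_apply]
  exact hk i hi

/-- A point lies in cylinders of measure at most `r ^ n`, where `r < 1` is the larger letter
probability. -/
lemma nullSingletonClass_bernoulliSeq {p : unitInterval} (hp0 : 0 < p) (hp1 : p < 1) :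
    NullSingletonClass (bernoulliSeq p) := by
  refine ⟨fun ω => ?_⟩
  have h0 : 0 < (p : ℝ) := hp0
  have h1 : (p : ℝ) < 1 := hp1
  set r : ENNReal := max (ENNReal.ofReal p) (ENNReal.ofReal (1 - p)) with hr
  have hr1 : r < 1 := by
    rw [hr, max_lt_iff, ENNReal.ofReal_lt_one, ENNReal.ofReal_lt_one]
    exact ⟨h1, by linarith⟩
  have hle : ∀ n : ℕ, bernoulliSeq p {ω} ≤ r ^ n := by
    intro n
    have hsub : ({ω} : Set (ℕ → Fin 2)) ⊆ Set.pi (Finset.range n) fun i => {ω i} := by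
      rintro η rfl i _
      rfl
    refine (measure_mono hsub).trans ?_
    rw [bernoulliSeq, Measure.infinitePi_pi _ fun i _ => measurableSet_singleton _]
    refine (Finset.prod_le_prod' (g := fun _ => r) fun i _ => ?_).trans (by simp)
    rcases Fin.exists_fin_two.1 ⟨ω i, rfl⟩ with h | h
    · rw [h, letterMeasure_zero]; exact le_max_left _ _
    · rw [h, letterMeasure_one]; exact le_max_right _ _
  exact le_antisymm (ge_of_tendsto' (ENNReal.tendsto_pow_atTop_nhds_zero_of_lt_one hr1) hle)
    zero_le

/-- For generic `x` no convention overrides the letters, so the signs spell out `ω`. -/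
lemma expansion_injective {x : ℝ} (hx : x ∈ genericPoints) :
    Function.Injective fun ω => expansion ω x := by
  have h : ∀ ω n, (expansion ω x n).1 = ω n := by
    intro ω n
    have := ((firstPair_eq_iff (ω := fun i => ω (n + i)) (orbit_mem_genericPoints hx ω n) _).1
      rfl).1
    rw [expansion_eq, iterate_randomMap, ← this]
    rfl
  intro ω ω' heq
  ext n
  have : expansion ω x n = expansion ω' x n := congrFun heq n
  rw [← h ω n, ← h ω' n, this]

/-- Almost every point has uncountably many universal expansions generated by the random map. -/
lemma ae_not_countable_universal {p : unitInterval} (hp0 : 0 < p) (hp1 : p < 1) :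
    ∀ᵐ x ∂unitVolume, ¬ {a : ℕ → Fin 2 × ℕ | (∃ ω : ℕ → Fin 2, a = expansion ω x) ∧
      IsExpansionOf a x ∧ IsUniversal a}.Countable := by
  have h1 : ∀ᵐ q ∂unitVolume.prod (bernoulliSeq p), IsUniversal (expansion q.2 q.1) :=
    Measure.measurePreserving_swap.quasiMeasurePreserving.ae (ae_isUniversal hp0 hp1)
  have h2 := Measure.ae_ae_of_ae_prod h1
  filter_upwards [h2, ae_mem_genericPoints] with x hx hgen hcount
  have := nullSingletonClass_bernoulliSeq hp0 hp1
  -- If the set were countable, injectivity would make its set of `ω` countable, hence null; yet by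
  -- Fubini almost every `ω` gives a universal expansion of this `x`.
  have hpre := hcount.preimage (expansion_injective hgen)
  have hnull := hpre.ae_notMem (bernoulliSeq p)
  obtain ⟨ω, hω1, hω2⟩ := (hx.and hnull).exists
  exact hω2 ⟨⟨ω, rfl⟩, isExpansionOf_expansion ω (genericPoints_subset hgen), hω1⟩

end RandomLuroth

theorem theoremB (p : unitInterval) (hp0 : 0 < p) (hp1 : p < 1) :
    -- uncountably many universal expansions, all generated by the random map
    (∀ᵐ x ∂(volume.restrict (Icc (0 : ℝ) 1)),
      ¬ {a : ℕ → Fin 2 × ℕ | (∃ ω : ℕ → Fin 2, a = RandomLuroth.expansion ω x) ∧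
          RandomLuroth.IsExpansionOf a x ∧ RandomLuroth.IsUniversal a}.Countable) ∧
    -- the speed of convergence is given by the Lyapunov exponent, wherever the latter exists
    (∀ (ω : ℕ → Fin 2) (x l : ℝ), x ∈ Ioc (0 : ℝ) 1 →
      RandomLuroth.HasLyapunovExponent ω x l → RandomLuroth.HasRate ω x (-l)) ∧
    -- the typical exponent and the typical rate
    (Summable fun k : ℕ =>
      Real.log (((k : ℝ) + 2) * ((k : ℝ) + 1)) / (((k : ℝ) + 2) * ((k : ℝ) + 1))) ∧
    (∀ᵐ z ∂(RandomLuroth.productMeasure p),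
      RandomLuroth.HasLyapunovExponent z.1 z.2 RandomLuroth.typicalExponent) ∧
    (∀ᵐ z ∂(RandomLuroth.productMeasure p),
      RandomLuroth.HasRate z.1 z.2 (-RandomLuroth.typicalExponent)) ∧
    -- the sets of all possible exponents and rates
    {l : ℝ | ∃ (ω : ℕ → Fin 2) (x : ℝ), x ∈ Ioc (0 : ℝ) 1 ∧
        RandomLuroth.HasLyapunovExponent ω x l} = Ici (Real.log 2) ∧
    {r : ℝ | ∃ (ω : ℕ → Fin 2) (x : ℝ), x ∈ Ioc (0 : ℝ) 1 ∧
        RandomLuroth.HasRate ω x r} = Iic (-Real.log 2) ∧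
    -- the averages of the approximation coefficients, and their expectations
    (∀ᵐ z ∂(RandomLuroth.productMeasure p),
      Tendsto (fun n : ℕ => 1 / (n : ℝ) * ∑ i ∈ Finset.range n, RandomLuroth.theta z.1 z.2 i)
        atTop (𝓝 (RandomLuroth.meanTheta p))) ∧
    (∀ n : ℕ, Integrable (fun z : (ℕ → Fin 2) × ℝ => RandomLuroth.theta z.1 z.2 n)
        (RandomLuroth.productMeasure p) ∧
      ∫ z, RandomLuroth.theta z.1 z.2 n ∂(RandomLuroth.productMeasure p) =
        RandomLuroth.meanTheta p) ∧
    -- the possible values of the limit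
    RandomLuroth.meanTheta '' Icc (0 : ℝ) 1 =
      Icc RandomLuroth.momentA RandomLuroth.momentL := by
  exact ⟨RandomLuroth.ae_not_countable_universal hp0 hp1,
    fun _ _ _ hx h =>
      RandomLuroth.hasRate_of_tendsto hx (RandomLuroth.tendsto_of_hasLyapunovExponent hx h),
    RandomLuroth.summable_typicalExponent, RandomLuroth.ae_hasLyapunovExponent p,
    RandomLuroth.ae_hasRate p, RandomLuroth.setOf_hasLyapunovExponent, RandomLuroth.setOf_hasRate,
    RandomLuroth.ae_tendsto_average_theta p, RandomLuroth.integral_theta p,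
    RandomLuroth.image_meanTheta⟩
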